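/- **Proposition 4.3.** Let $P\subset\mathbb{R}^d$ be a lattice polygon, that is, a two-dimensional polytope whose vertices lie in $\mathbb{Z}^d$. For $x\in\mathbb{R}^d$ write $x^2=x\otimes x$ for the symmetric tensor of rank $2$, i.e. the bilinear form $(u,w)\mapsto (x\cdot u)(x\cdot w)$, and put $L^2(S)=\sum_{x\in S\cap\mathbb{Z}^d}x^2$ for bounded $S\subset\mathbb{R}^d$. The $h^2$-tensor polynomial of $P$ is the polynomial $h^2_P(t)=\sum_{i=0}^{4}h^2_i(P)\,t^i$ whose coefficients are the symmetric tensors of rank $2$ with $$L^2(nP)=\sum_{i=0}^{4}h^2_i(P)\binom{n+4-i}{4}\qquad\text{for all integers } n\ge 0 .$$ Let $\mathcal{T}$ be a unimodular triangulation of $P$: a finite triangulation of $P$ into triangles with vertices in $\mathbb{Z}^d$ such that the edge vectors of each triangle generate the group of all integer vectors parallel to the plane of $P$ (for $d=2$: each triangle has area $1/2$). Let $V=P\cap\mathbb{Z}^d$, let $E$ be the set of edges of $\mathcal{T}$, let $V^\circ$ be the set of lattice points in the relative interior of $P$, and let $E^\circ$ be the set of edges $\{y,z\}\in E$ such that the open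 segment $(y,z)$ is not contained in the relative boundary of $P$. Then the $h^2$-tensor polynomial of $P$ exists, is unique, and equals $$h^2_P(t)=t\sum_{x\in V}x^2+t^2\Big(\sum_{\{y,z\}\in E}(y+z)^2-\sum_{x\in V}x^2\Big)+t^3\Big(\sum_{\{y,z\}\in E^\circ}(y+z)^2-\sum_{x\in V^\circ}x^2\Big)+t^4\sum_{x\in V^\circ}x^2 .$$ -/

import Mathlib

open scoped Pointwise

noncomputable section

namespace EhrhartTensor

/-- The ambient Euclidean space `ℝ^d`. -/
abbrev E (d : ℕ) : Type := EuclideanSpace ℝ (Fin d)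

/-- The integer lattice `ℤ^d` inside `ℝ^d`. -/
def lattice (d : ℕ) : Set (E d) := {x | ∀ i, ∃ m : ℤ, x i = m}

/-- The vector space `𝕋^r` of symmetric tensors of rank `r` on `ℝ^d`, realised as the
multilinear functionals `(ℝ^d)^r → ℝ` that are invariant under permutations of the arguments. -/
def SymTensor (d r : ℕ) : Submodule ℝ (MultilinearMap ℝ (fun _ : Fin r => E d) ℝ) where
  carrier := {T | ∀ (σ : Equiv.Perm (Fin r)) (u : Fin r → E d), T (u ∘ σ) = T u}
  zero_mem' := fun _ _ => rfl
  add_mem' := by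
    intro S T hS hT σ u
    simp only [add_apply, hS σ u, hT σ u]
  smul_mem' := by
    intro c T hT σ u
    simp only [smul_apply, hT σ u]

/-- The tensor power `x^r = x ⊗ ⋯ ⊗ x`: the functional `(u₁, …, u_r) ↦ (x · u₁) ⋯ (x · u_r)`. -/
def tensorPow {d : ℕ} (r : ℕ) (x : E d) : SymTensor d r :=
  ⟨(MultilinearMap.mkPiAlgebra ℝ (Fin r) ℝ).compLinearMap (fun _ => innerₛₗ ℝ x), by
    intro σ u
    simpa using Equiv.prod_comp σ (fun i => inner ℝ x (u i))⟩

/-- `tensorPow r x` is the functional `(u₁, …, u_r) ↦ (x · u₁) ⋯ (x · u_r)`. -/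
theorem tensorPow_apply {d : ℕ} (r : ℕ) (x : E d) (u : Fin r → E d) :
    (tensorPow r x : MultilinearMap ℝ (fun _ : Fin r => E d) ℝ) u = ∏ i, inner ℝ x (u i) := by
  simp [tensorPow]

/-- The discrete moment tensor `L^r(S) = ∑_{x ∈ S ∩ ℤ^d} x^r`
(a finite sum whenever `S` is bounded). -/
def discreteMoment {d : ℕ} (r : ℕ) (S : Set (E d)) : SymTensor d r :=
  ∑ᶠ x ∈ S ∩ lattice d, tensorPow r x

/-- `P` is a lattice polytope: the convex hull of finitely many lattice points. -/
def IsLatticePolytope {d : ℕ} (P : Set (E d)) : Prop :=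
  ∃ s : Finset (E d), (s : Set (E d)) ⊆ lattice d ∧ P = convexHull ℝ (s : Set (E d))

/-- The dimension of (the affine hull of) a nonempty set. -/
def dim {d : ℕ} (P : Set (E d)) : ℕ := Module.finrank ℝ (vectorSpan ℝ P)

/-- A lattice polygon: a two-dimensional lattice polytope. -/
def IsLatticePolygon {d : ℕ} (P : Set (E d)) : Prop := IsLatticePolytope P ∧ dim P = 2

/-- `h = ∑ h_i t^i` is the `h^r`-tensor polynomial of `P`: it has degree at most `dim P + r`, and
`L^r(nP) = ∑_{i=0}^{dim P + r} h_i * binom(n + dim P + r - i, dim P + r)` for all `n ≥ 0`. -/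
def IsHTensorPolynomial {d : ℕ} (r : ℕ) (P : Set (E d))
    (h : PolynomialModule ℝ (SymTensor d r)) : Prop :=
  (∀ i, dim P + r < i → h.coeff i = 0) ∧
  ∀ n : ℕ, discreteMoment r ((n : ℝ) • P) =
    ∑ i ∈ Finset.range (dim P + r + 1),
      ((n + dim P + r - i).choose (dim P + r) : ℝ) • h.coeff i

/-- The simplex with vertex set `s` is a unimodular lattice simplex: its vertices are lattice
points, and their differences generate the group of all lattice vectors parallel to it. -/
def IsUnimodularSimplex {d : ℕ} (s : Finset (E d)) : Prop :=
  (s : Set (E d)) ⊆ lattice d ∧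
  ∀ w ∈ lattice d, w ∈ vectorSpan ℝ (s : Set (E d)) → w ∈ vectorSpan ℤ (s : Set (E d))

/-- `K` is a unimodular triangulation of `P`: a finite simplicial complex with underlying space
`P` all of whose maximal cells are unimodular lattice simplices. -/
structure IsUnimodularTriangulation {d : ℕ} (P : Set (E d))
    (K : Geometry.SimplicialComplex ℝ (E d)) : Prop where
  finite : K.faces.Finite
  space_eq : K.space = P
  unimodular : ∀ s ∈ K.facets, IsUnimodularSimplex s

/-- The edges of `K`, each given as its set `{y, z}` of endpoints. -/
def edges {d : ℕ} (K : Geometry.SimplicialComplex ℝ (E d)) : Set (Finset (E d)) :=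
  {e | e ∈ K.faces ∧ e.card = 2}

/-- The interior edges: the edges `{y, z}` such that the open segment `(y, z)` is not contained
in the (relative) boundary of `P`. -/
def interiorEdges {d : ℕ} (P : Set (E d)) (K : Geometry.SimplicialComplex ℝ (E d)) :
    Set (Finset (E d)) :=
  {e | e ∈ edges K ∧ ∃ y z : E d, y ≠ z ∧ (e : Set (E d)) = {y, z} ∧
    ¬ openSegment ℝ y z ⊆ intrinsicFrontier ℝ P}

/-- `∑_{x ∈ V} x^2`, where `V` is the set of lattice points of `P`. -/
def sumV {d : ℕ} (P : Set (E d)) : SymTensor d 2 :=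
  ∑ᶠ x ∈ P ∩ lattice d, tensorPow 2 x

/-- `∑_{x ∈ V°} x^2`, where `V°` is the set of lattice points in the relative interior of `P`. -/
def sumVo {d : ℕ} (P : Set (E d)) : SymTensor d 2 :=
  ∑ᶠ x ∈ intrinsicInterior ℝ P ∩ lattice d, tensorPow 2 x

/-- `∑_{{y, z} ∈ F} (y + z)^2` for a set `F` of edges. -/
def sumEdges {d : ℕ} (F : Set (Finset (E d))) : SymTensor d 2 :=
  ∑ᶠ e ∈ F, tensorPow 2 (∑ v ∈ e, v)

end EhrhartTensor

end

/-! For `n ≥ 1`, every lattice point of `nP` lies in the relative interior of the dilate of exactly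
one face of `K`. Unimodularity makes it a combination of the vertices of that face with positive
integer weights of sum `n` (`smul_inter_lattice_eq_biUnion_cell`, `cell_disjoint`). Evaluated on a
pair of vectors, the moment is a sum of products of two linear forms, and power sums give the
contribution of each face for `n = m + 1`. A vertex contributes `(m+1)² v²`, an edge `C(m+1,3) ∑ v²
+ C(m+2,3) (y+z)²`, and a triangle `C(m+2,4) ∑ (y+z)² - C(m+1,3) ∑ v²` over its edges and vertices.

Summing over `K` leaves two incidence counts. An edge lies in two triangles if it is interior and in
one otherwise (`card_triangles_at_edge`). At a vertex the edges outnumber the triangles by one on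
the relative boundary and by zero inside (`card_edges_at_vertex`). Hence the boundary vertices carry
the factor `C(m+1,3)`, and the edge sums over `E` and `E°` both carry `C(m+2,4)`. Binomial
identities then give the stated coefficients.

Both counts are proved with an area form on the plane of `P`: each edge with points of `P` on its
left has exactly one triangle there.

Uniqueness holds because the defining equations at `n = 0, …, 4` form a unitriangular system in the
coefficients. -/

namespace EhrhartTensor

/-! ### Supporting functionals and the relative interior -/

section Support

variable {V : Type*} [NormedAddCommGroup V] [NormedSpace ℝ V]

/-- A linear functional attaining its minimum over `P` at a relative interior point of `P` is
constant on `P`. -/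
theorem eq_of_mem_intrinsicInterior_of_le {P : Set V} {x : V} (hx : x ∈ intrinsicInterior ℝ P)
    (f : V →ₗ[ℝ] ℝ) (hf : ∀ p ∈ P, f x ≤ f p) {p : V} (hp : p ∈ P) : f p = f x := by
  obtain ⟨y, hy, rfl⟩ := mem_intrinsicInterior.1 hx
  have hpA : p ∈ affineSpan ℝ P := subset_affineSpan ℝ P hp
  have : Nonempty (affineSpan ℝ P) := ⟨y⟩
  -- The line through `y` and `p`, run backwards past `y`, stays in `P` for a while. If `f p`
  -- exceeded `f y`, then `f` would drop below its minimum there.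
  let g : ℝ → affineSpan ℝ P := fun t => AffineMap.lineMap y (⟨p, hpA⟩ : affineSpan ℝ P) t
  have hg : Continuous g := AffineMap.lineMap_continuous
  have h0 : g 0 = y := by simp [g]
  have hmem : g ⁻¹' (interior ((↑) ⁻¹' P : Set (affineSpan ℝ P))) ∈ nhds (0 : ℝ) :=
    hg.continuousAt.preimage_mem_nhds (by rw [h0]; exact isOpen_interior.mem_nhds hy)
  obtain ⟨ε, hε, hball⟩ := Metric.mem_nhds_iff.1 hmem
  have h1 : g (-(ε / 2)) ∈ interior ((↑) ⁻¹' P : Set (affineSpan ℝ P)) :=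
    hball (by simp [abs_of_pos hε, hε])
  have h2 : ((g (-(ε / 2)) : affineSpan ℝ P) : V) ∈ P := (interior_subset h1 : g (-(ε / 2)) ∈ ((↑) ⁻¹' P : Set (affineSpan ℝ P)))
  have h3 := hf _ h2
  have h4 : ((g (-(ε / 2)) : affineSpan ℝ P) : V) = (y : V) + (-(ε / 2)) • (p - y) := by
    simp [g, AffineMap.lineMap_apply, add_comm]
  rw [h4, map_add, map_smul, map_sub, smul_eq_mul] at h3
  have := hf p hp
  nlinarith

/-- A point of a convex set outside of its relative interior admits a proper supporting linear
functional. -/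
theorem exists_support_of_notMem_intrinsicInterior [FiniteDimensional ℝ V] {P : Set V}
    (hP : Convex ℝ P) {x : V} (hxP : x ∈ P) (hx : x ∉ intrinsicInterior ℝ P) :
    ∃ f : V →ₗ[ℝ] ℝ, (∀ p ∈ P, f x ≤ f p) ∧ ∃ p ∈ P, f p ≠ f x := by
  have hxA : x ∈ affineSpan ℝ P := subset_affineSpan ℝ P hxP
  have : Nonempty (affineSpan ℝ P) := ⟨⟨x, hxA⟩⟩
  -- Moving `x` to the origin of the direction space turns the relative interior into an ordinary
  -- interior, where Hahn–Banach applies.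
  let φ : (affineSpan ℝ P).direction →ᵃⁱ[ℝ] V :=
    (affineSpan ℝ P).subtypeₐᵢ.comp
      (AffineIsometryEquiv.vaddConst ℝ (⟨x, hxA⟩ : affineSpan ℝ P)).toAffineIsometry
  have hφ : ∀ w, φ w = (w : V) + x := fun w => rfl
  set Q : Set (affineSpan ℝ P).direction := φ ⁻¹' P with hQ
  have himg : φ '' Q = P := by
    apply Set.image_preimage_eq_of_subset
    intro p hp
    refine ⟨⟨p - x, ?_⟩, by simp [hφ]⟩
    exact AffineSubspace.vsub_mem_direction (subset_affineSpan ℝ P hp) hxA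
  have hQc : Convex ℝ Q := hP.affine_preimage φ.toAffineMap
  have hspan : affineSpan ℝ Q = ⊤ := by
    have h1 : (affineSpan ℝ Q).map φ.toAffineMap = affineSpan ℝ P := by
      rw [AffineSubspace.map_span]
      exact congrArg _ himg
    apply eq_top_iff.2
    intro w _
    have : φ w ∈ affineSpan ℝ P := by
      rw [hφ]; exact AffineSubspace.vadd_mem_of_mem_direction w.2 hxA
    obtain ⟨w', hw', he⟩ := h1.ge this
    rwa [φ.injective he] at hw'
  have hne : (interior Q).Nonempty := hQc.interior_nonempty_iff_affineSpan_eq_top.2 hspan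
  have h0 : (0 : (affineSpan ℝ P).direction) ∉ interior Q := by
    intro h
    apply hx
    rw [← himg, AffineIsometry.intrinsicInterior_image]
    exact ⟨0, interior_subset_intrinsicInterior h, by simp [hφ]⟩
  obtain ⟨f, hf⟩ := geometric_hahn_banach_open_point hQc.interior isOpen_interior h0
  obtain ⟨g, hg⟩ := LinearMap.exists_extend (-(f : (affineSpan ℝ P).direction →ₗ[ℝ] ℝ))
  have hgw : ∀ w : (affineSpan ℝ P).direction, g w = - f w := fun w => by
    simpa using LinearMap.congr_fun hg w
  -- The separation is known on the interior of `Q` only; it extends to `Q` since the interior of a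
  -- convex set is dense in it once nonempty.
  have hle : ∀ w ∈ Q, f w ≤ 0 := by
    intro w hw
    have hcl : w ∈ closure (interior Q) := by
      rw [hQc.closure_interior_eq_closure_of_nonempty_interior hne]
      exact subset_closure hw
    refine closure_minimal (t := {w | f w ≤ 0}) ?_ (isClosed_le f.continuous continuous_const) hcl
    intro w hw
    simpa using (hf w hw).le
  refine ⟨g, ?_, ?_⟩
  · intro p hp
    rw [← himg] at hp
    obtain ⟨w, hw, rfl⟩ := hp
    rw [hφ, map_add, hgw]
    linarith [hle w hw]
  · obtain ⟨w, hw⟩ := hne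
    refine ⟨φ w, (interior_subset hw : w ∈ Q), ?_⟩
    rw [hφ, map_add, hgw]
    have := hf w hw
    rw [map_zero] at this
    intro h
    linarith

end Support

/-! ### Barycentric weights and the open cells of a complex -/

section Cells

variable {V : Type*} [AddCommGroup V] [Module ℝ V]

/-- Barycentric coordinates with respect to an affinely independent set are unique. -/
theorem weights_unique {s : Finset V} (hs : AffineIndependent ℝ ((↑) : s → V)) {a b : V → ℝ}
    (h1 : ∑ v ∈ s, a v = ∑ v ∈ s, b v) (h2 : ∑ v ∈ s, a v • v = ∑ v ∈ s, b v • v) :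
    ∀ v ∈ s, a v = b v := by
  rw [affineIndependent_iff] at hs
  intro v hv
  have := hs Finset.univ (fun x => a x - b x)
    (by rw [Finset.sum_coe_sort s (fun x => a x - b x), Finset.sum_sub_distrib, h1, sub_self])
    (by
      rw [Finset.sum_coe_sort s (fun x => (a x - b x) • x)]
      simp_rw [sub_smul]
      rw [Finset.sum_sub_distrib, h2, sub_self])
    ⟨v, hv⟩ (Finset.mem_univ _)
  exact sub_eq_zero.1 this

/-- A relative interior point of a simplex lies on no proper face. -/
theorem subset_of_pos_weights_of_mem_convexHull {s t : Finset V}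
    (hs : AffineIndependent ℝ ((↑) : s → V)) (hts : t ⊆ s) {w : V → ℝ}
    (hw : ∀ v ∈ s, 0 < w v) (hw1 : ∑ v ∈ s, w v = 1)
    (h : ∑ v ∈ s, w v • v ∈ convexHull ℝ (t : Set V)) : s ⊆ t := by
  classical
  obtain ⟨b, hb0, hb1, hb⟩ := Finset.mem_convexHull'.1 h
  intro v hv
  by_contra hvt
  have := weights_unique hs (a := w) (b := fun v => if v ∈ t then b v else 0)
    (by rw [Finset.sum_ite_mem, Finset.inter_eq_right.2 hts, hw1, hb1])
    (by simp_rw [ite_smul, zero_smul]; rw [Finset.sum_ite_mem, Finset.inter_eq_right.2 hts, hb]) v hv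
  rw [if_neg hvt] at this
  exact (hw v hv).ne' this

/-- A face meeting the relative interior of a simplex of a complex contains that simplex. -/
theorem subset_of_pos_weights_of_mem_face {K : Geometry.SimplicialComplex ℝ V} {s t : Finset V}
    (hs : s ∈ K.faces) (ht : t ∈ K.faces) {w : V → ℝ}
    (hw : ∀ v ∈ s, 0 < w v) (hw1 : ∑ v ∈ s, w v = 1)
    (h : ∑ v ∈ s, w v • v ∈ convexHull ℝ (t : Set V)) : s ⊆ t := by
  classical
  have hself : ∑ v ∈ s, w v • v ∈ convexHull ℝ (s : Set V) :=
    Finset.mem_convexHull'.2 ⟨w, fun v hv => (hw v hv).le, hw1, rfl⟩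
  have := K.inter_subset_convexHull hs ht ⟨hself, h⟩
  rw [← Finset.coe_inter] at this
  exact (subset_of_pos_weights_of_mem_convexHull (K.indep hs) Finset.inter_subset_left hw hw1
    this).trans Finset.inter_subset_right

/-- The combinations of the points of `s` with positive integer weights of sum `n`. For a
unimodular simplex these are the lattice points in the relative interior of its `n`-th dilate. -/
def cell (n : ℕ) (s : Finset V) : Set V :=
  {x | ∃ k : V → ℕ, (∀ v ∈ s, 0 < k v) ∧ ∑ v ∈ s, k v = n ∧ ∑ v ∈ s, (k v : ℝ) • v = x}

theorem exists_weights_of_mem_cell {n : ℕ} (hn : n ≠ 0) {s : Finset V} {x : V}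
    (hx : x ∈ cell n s) : ∃ w : V → ℝ, (∀ v ∈ s, 0 < w v) ∧ ∑ v ∈ s, w v = 1 ∧
      ∑ v ∈ s, w v • v = (n : ℝ)⁻¹ • x := by
  obtain ⟨k, hk, hkn, rfl⟩ := hx
  have hn' : (0 : ℝ) < n := by positivity
  refine ⟨fun v => (n : ℝ)⁻¹ * k v, fun v hv => ?_, ?_, ?_⟩
  · have : (0 : ℝ) < k v := by exact_mod_cast hk v hv
    positivity
  · rw [← Finset.mul_sum, ← Nat.cast_sum, hkn, inv_mul_cancel₀ hn'.ne']
  · rw [Finset.smul_sum]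
    simp_rw [mul_smul]

theorem cell_disjoint {K : Geometry.SimplicialComplex ℝ V} {n : ℕ} (hn : n ≠ 0) {s t : Finset V}
    (hs : s ∈ K.faces) (ht : t ∈ K.faces) (hst : s ≠ t) : Disjoint (cell n s) (cell n t) := by
  have key : ∀ {s t : Finset V}, s ∈ K.faces → t ∈ K.faces → ∀ x ∈ cell n s, x ∈ cell n t →
      s ⊆ t := by
    intro s t hs ht x hxs hxt
    obtain ⟨w, hw, hw1, hwx⟩ := exists_weights_of_mem_cell hn hxs
    obtain ⟨b, hb, hb1, hbx⟩ := exists_weights_of_mem_cell hn hxt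
    refine subset_of_pos_weights_of_mem_face hs ht hw hw1 ?_
    rw [hwx]
    exact Finset.mem_convexHull'.2 ⟨b, fun v hv => (hb v hv).le, hb1, hbx⟩
  rw [Set.disjoint_left]
  intro x hxs hxt
  exact hst ((key hs ht x hxs hxt).antisymm (key ht hs x hxt hxs))

/-- Unimodularity is assumed of facets only; through this lemma it is used for all faces. -/
theorem exists_facet_superset {K : Geometry.SimplicialComplex ℝ V} (hK : K.faces.Finite)
    {s : Finset V} (hs : s ∈ K.faces) : ∃ t ∈ K.facets, s ⊆ t := by
  obtain ⟨t, hst, ht⟩ := hK.exists_le_maximal hs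
  exact ⟨t, ⟨ht.prop, fun u hu htu => htu.antisymm (ht.le_of_ge hu htu)⟩, hst⟩

theorem exists_int_weights_of_mem_vectorSpan {s : Finset V} {x : V}
    (hx : x ∈ vectorSpan ℤ (s : Set V)) :
    ∃ k : V → ℤ, ∑ v ∈ s, k v = 0 ∧ ∑ v ∈ s, (k v : ℝ) • v = x := by
  classical
  rw [vectorSpan_def] at hx
  induction hx using Submodule.span_induction with
  | mem x h =>
    obtain ⟨a, ha, b, hb, rfl⟩ := Set.mem_vsub.1 h
    refine ⟨fun v => (if v = a then 1 else 0) - (if v = b then 1 else 0), ?_, ?_⟩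
    · rw [Finset.sum_sub_distrib, Finset.sum_ite_eq_of_mem' _ _ _ ha,
        Finset.sum_ite_eq_of_mem' _ _ _ hb, sub_self]
    · push_cast
      simp_rw [sub_smul, ite_smul, one_smul, zero_smul]
      rw [Finset.sum_sub_distrib, Finset.sum_ite_eq_of_mem' _ _ _ ha,
        Finset.sum_ite_eq_of_mem' _ _ _ hb, vsub_eq_sub]
  | zero => exact ⟨0, by simp, by simp⟩
  | add x y _ _ hx hy =>
    obtain ⟨k, hk, rfl⟩ := hx
    obtain ⟨l, hl, rfl⟩ := hy
    exact ⟨k + l, by simp [Finset.sum_add_distrib, hk, hl],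
      by simp [Finset.sum_add_distrib, add_smul]⟩
  | smul c x _ hx =>
    obtain ⟨k, hk, rfl⟩ := hx
    exact ⟨fun v => c * k v, by rw [← Finset.mul_sum, hk, mul_zero],
      by simp [Finset.smul_sum, mul_smul, Int.cast_smul_eq_zsmul]⟩

end Cells

/-! ### Lattice points of dilates along a unimodular triangulation -/

section Lattice

variable {d : ℕ}

theorem natCast_smul_mem_lattice {x : E d} (n : ℕ) (hx : x ∈ lattice d) :
    (n : ℝ) • x ∈ lattice d := fun i => by
  obtain ⟨m, hm⟩ := hx i
  exact ⟨n * m, by simp [hm]⟩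

theorem sub_mem_lattice {x y : E d} (hx : x ∈ lattice d) (hy : y ∈ lattice d) :
    x - y ∈ lattice d := fun i => by
  obtain ⟨m, hm⟩ := hx i
  obtain ⟨l, hl⟩ := hy i
  exact ⟨m - l, by simp [hm, hl]⟩

theorem sum_mem_lattice {ι : Type*} {s : Finset ι} {f : ι → E d}
    (h : ∀ i ∈ s, f i ∈ lattice d) : ∑ i ∈ s, f i ∈ lattice d := by
  classical
  induction s using Finset.induction_on with
  | empty => exact fun i => ⟨0, by simp⟩
  | insert a s ha ih =>
    rw [Finset.sum_insert ha]
    intro i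
    obtain ⟨m, hm⟩ := h a (Finset.mem_insert_self _ _) i
    obtain ⟨l, hl⟩ := ih (fun j hj => h j (Finset.mem_insert_of_mem hj)) i
    exact ⟨m + l, by simp [hm, hl]⟩

/-- The lattice points of the `n`-th dilate of a unimodular simplex are the combinations of its
vertices with nonnegative integer weights of sum `n`. -/
theorem exists_nat_weights_of_isUnimodularSimplex {s : Finset (E d)}
    (hs : AffineIndependent ℝ ((↑) : s → E d)) (hu : IsUnimodularSimplex s) {n : ℕ} {y : E d}
    (hy : y ∈ convexHull ℝ (s : Set (E d))) (hny : (n : ℝ) • y ∈ lattice d) :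
    ∃ k : E d → ℕ, ∑ v ∈ s, k v = n ∧ ∑ v ∈ s, (k v : ℝ) • v = (n : ℝ) • y := by
  classical
  obtain ⟨v₀, hv₀⟩ : (s : Set (E d)).Nonempty := convexHull_nonempty_iff.1 ⟨y, hy⟩
  obtain ⟨b, hb0, hb1, hb⟩ := Finset.mem_convexHull'.1 hy
  have hmem : (n : ℝ) • y - (n : ℝ) • v₀ ∈ vectorSpan ℝ (s : Set (E d)) := by
    rw [← smul_sub]
    refine Submodule.smul_mem _ _ ?_
    exact vsub_mem_vectorSpan_of_mem_affineSpan_of_mem_affineSpan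
      (convexHull_subset_affineSpan _ hy) (subset_affineSpan ℝ _ hv₀)
  obtain ⟨k, hk0, hk⟩ := exists_int_weights_of_mem_vectorSpan
    (hu.2 _ (sub_mem_lattice hny (natCast_smul_mem_lattice n (hu.1 hv₀))) hmem)
  -- The integer weights of `n • y - n • v₀`, raised by `n` at `v₀`, are weights of `n • y`. By
  -- uniqueness they equal `n * b`, so the numbers `n * b v` are nonnegative integers.
  have hk' := weights_unique hs (a := fun v => (k v : ℝ) + if v = v₀ then (n : ℝ) else 0)
    (b := fun v => n * b v)
    (by
      rw [Finset.sum_add_distrib, Finset.sum_ite_eq_of_mem' _ _ _ hv₀, ← Finset.mul_sum, hb1,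
        ← Int.cast_sum, hk0]
      simp)
    (by
      simp_rw [add_smul, ite_smul, zero_smul, mul_smul]
      rw [Finset.sum_add_distrib, Finset.sum_ite_eq_of_mem' _ _ _ hv₀, ← Finset.smul_sum, hb, hk]
      simp)
  have hl : ∀ v ∈ s, ∃ m : ℕ, (m : ℝ) = n * b v := by
    intro v hv
    have h1 : ((k v + if v = v₀ then (n : ℤ) else 0 : ℤ) : ℝ) = n * b v := by
      rw [← hk' v hv]; push_cast; rfl
    have h2 : (0 : ℤ) ≤ k v + if v = v₀ then (n : ℤ) else 0 := by
      have : (0 : ℝ) ≤ n * b v := mul_nonneg n.cast_nonneg (hb0 v hv)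
      rw [← h1] at this
      exact_mod_cast this
    obtain ⟨m, hm⟩ := Int.eq_ofNat_of_zero_le h2
    exact ⟨m, by rw [← h1, hm]; simp⟩
  choose! l hl using hl
  refine ⟨l, ?_, ?_⟩
  · have : ((∑ v ∈ s, l v : ℕ) : ℝ) = n := by
      rw [Nat.cast_sum, Finset.sum_congr rfl hl, ← Finset.mul_sum, hb1, mul_one]
    exact_mod_cast this
  · rw [Finset.sum_congr rfl (fun v hv => by rw [hl v hv, mul_smul]), ← Finset.smul_sum, hb]

variable {P : Set (E d)} {K : Geometry.SimplicialComplex ℝ (E d)}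

theorem face_subset_lattice (hK : IsUnimodularTriangulation P K) {s : Finset (E d)}
    (hs : s ∈ K.faces) : (s : Set (E d)) ⊆ lattice d := by
  obtain ⟨t, ht, hst⟩ := exists_facet_superset hK.finite hs
  exact (Finset.coe_subset.2 hst).trans (hK.unimodular t ht).1

/-- The lattice points of a dilate of `P`, decomposed along a unimodular triangulation. -/
theorem smul_inter_lattice_eq_biUnion_cell (hK : IsUnimodularTriangulation P K) {n : ℕ}
    (hn : n ≠ 0) : ((n : ℝ) • P) ∩ lattice d = ⋃ s ∈ K.faces, cell n s := by
  classical
  have hn' : (n : ℝ) ≠ 0 := by positivity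
  ext x
  simp only [Set.mem_inter_iff, Set.mem_iUnion, exists_prop]
  constructor
  · rintro ⟨⟨y, hy, rfl⟩, hx⟩
    rw [← hK.space_eq, Geometry.SimplicialComplex.mem_space_iff] at hy
    obtain ⟨s, hs, hy⟩ := hy
    obtain ⟨t, ht, hst⟩ := exists_facet_superset hK.finite hs
    obtain ⟨k, hk, hkx⟩ := exists_nat_weights_of_isUnimodularSimplex (K.indep ht.1)
      (hK.unimodular t ht) (convexHull_mono (Finset.coe_subset.2 hst) hy) hx
    have hsum : ∑ v ∈ t with k v ≠ 0, k v = n := by rw [Finset.sum_filter_ne_zero, hk]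
    -- Dropping the vertices of weight zero leaves the face whose relative interior contains the
    -- point; it is nonempty because the weights sum to `n ≠ 0`.
    refine ⟨t.filter (fun v => k v ≠ 0), K.down_closed ht.1 (Finset.filter_subset _ _) ?_, k,
      fun v hv => Nat.pos_of_ne_zero (Finset.mem_filter.1 hv).2, hsum, ?_⟩
    · by_contra h
      rw [Finset.not_nonempty_iff_eq_empty] at h
      rw [h, Finset.sum_empty] at hsum
      exact hn hsum.symm
    · show _ = (n : ℝ) • y
      rw [← hkx]
      refine Finset.sum_filter_of_ne fun v _ h h0 => h ?_
      rw [h0, Nat.cast_zero, zero_smul]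
  · rintro ⟨s, hs, hx⟩
    constructor
    · obtain ⟨w, hw, hw1, hwx⟩ := exists_weights_of_mem_cell hn hx
      refine ⟨(n : ℝ)⁻¹ • x, ?_, smul_inv_smul₀ hn' x⟩
      rw [← hK.space_eq, Geometry.SimplicialComplex.mem_space_iff]
      exact ⟨s, hs, Finset.mem_convexHull'.2 ⟨w, fun v hv => (hw v hv).le, hw1, hwx⟩⟩
    · obtain ⟨k, -, -, rfl⟩ := hx
      exact sum_mem_lattice fun v hv =>
        natCast_smul_mem_lattice _ (face_subset_lattice hK hs hv)

/-- This is the case `n = 1` of the cell decomposition: positive integers with sum `1` leave room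
for one vertex only. -/
theorem inter_lattice_eq_vertices (hK : IsUnimodularTriangulation P K) :
    P ∩ lattice d = K.vertices := by
  have h := smul_inter_lattice_eq_biUnion_cell hK one_ne_zero
  rw [Nat.cast_one, one_smul] at h
  rw [h]
  ext x
  simp only [Set.mem_iUnion, exists_prop, Geometry.SimplicialComplex.mem_vertices]
  constructor
  · rintro ⟨s, hs, k, hk, hk1, rfl⟩
    obtain ⟨v, hv⟩ := Geometry.SimplicialComplex.nonempty_of_mem_faces hs
    have hcard : s.card ≤ 1 := by
      rw [← hk1, Finset.card_eq_sum_ones]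
      exact Finset.sum_le_sum fun v hv => hk v hv
    have hsv : s = {v} := Finset.eq_singleton_iff_unique_mem.2
      ⟨hv, fun u hu => Finset.card_le_one.1 hcard u hu v hv⟩
    subst hsv
    simp only [Finset.sum_singleton] at hk1 ⊢
    simpa [hk1] using hs
  · intro hx
    exact ⟨{x}, hx, fun _ => 1, by simp, by simp, by simp⟩

end Lattice

/-! ### Closed forms for sums over integer weights -/

section PowerSums

theorem sum_range_cubic (A B C D : ℝ) (m : ℕ) :
    ∑ i ∈ Finset.range m, (A * (i : ℝ) ^ 3 + B * (i : ℝ) ^ 2 + C * i + D) =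
      A * (m * (m - 1) / 2) ^ 2 + B * (m * (m - 1) * (2 * m - 1) / 6) + C * (m * (m - 1) / 2)
        + D * m := by
  induction m with
  | zero => simp
  | succ m ih =>
    rw [Finset.sum_range_succ, ih]
    push_cast
    ring

theorem cast_choose_three (n : ℕ) : (n.choose 3 : ℝ) = n * (n - 1) * (n - 2) / 6 := by
  induction n with
  | zero => simp
  | succ n ih =>
    rw [Nat.choose_succ_succ' n 2, Nat.cast_add, ih, Nat.cast_choose_two]
    push_cast
    ring

theorem cast_choose_four (n : ℕ) : (n.choose 4 : ℝ) = n * (n - 1) * (n - 2) * (n - 3) / 24 := by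
  induction n with
  | zero => simp
  | succ n ih =>
    rw [Nat.choose_succ_succ' n 3, Nat.cast_add, ih, cast_choose_three]
    push_cast
    ring

/-- The weights `i + 1` and `m - i` run over all pairs of positive integers with sum `m + 1`. -/
theorem sum_range_edge (y z y' z' : ℝ) (m : ℕ) :
    ∑ i ∈ Finset.range m, (((i : ℝ) + 1) * y + (m - i) * z) * ((i + 1) * y' + (m - i) * z') =
      ((m + 1).choose 3 : ℝ) * (y * y' + z * z')
        + ((m + 2).choose 3 : ℝ) * ((y + z) * (y' + z')) := by
  rw [Finset.sum_congr rfl (fun (i : ℕ) _ =>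
    show (((i : ℝ) + 1) * y + (m - i) * z) * ((i + 1) * y' + (m - i) * z') =
      0 * (i : ℝ) ^ 3 + (y - z) * (y' - z') * (i : ℝ) ^ 2
        + ((y - z) * (y' + m * z') + (y + m * z) * (y' - z')) * i
        + (y + m * z) * (y' + m * z') by ring), sum_range_cubic, cast_choose_three,
    cast_choose_three]
  push_cast
  ring

/-- The weights `i + 1`, `j - i`, `m - j` run over all triples of positive integers with sum `m +
1`. Two summations of a quadratic in `i` produce a quartic in `m`. -/
theorem sum_range_triangle (y z c y' z' c' : ℝ) (m : ℕ) :
    ∑ j ∈ Finset.range m, ∑ i ∈ Finset.range j,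
      (((i : ℝ) + 1) * y + (j - i) * z + (m - j) * c) *
        ((i + 1) * y' + (j - i) * z' + (m - j) * c') =
      ((m + 2).choose 4 : ℝ) *
          ((y + z) * (y' + z') + (y + c) * (y' + c') + (z + c) * (z' + c'))
        - ((m + 1).choose 3 : ℝ) * (y * y' + z * z' + c * c') := by
  have inner : ∀ j : ℕ, ∑ i ∈ Finset.range j,
      (((i : ℝ) + 1) * y + (j - i) * z + (m - j) * c) *
        ((i + 1) * y' + (j - i) * z' + (m - j) * c') =
      (y - z) * (y' - z') * (j * (j - 1) * (2 * j - 1) / 6)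
        + ((y - z) * (y' + j * z' + (m - j) * c') + (y + j * z + (m - j) * c) * (y' - z'))
          * (j * (j - 1) / 2)
        + (y + j * z + (m - j) * c) * (y' + j * z' + (m - j) * c') * j := by
    intro j
    rw [Finset.sum_congr rfl (fun (i : ℕ) _ =>
      show (((i : ℝ) + 1) * y + (j - i) * z + (m - j) * c) *
        ((i + 1) * y' + (j - i) * z' + (m - j) * c') =
        0 * (i : ℝ) ^ 3 + (y - z) * (y' - z') * (i : ℝ) ^ 2
          + ((y - z) * (y' + j * z' + (m - j) * c') + (y + j * z + (m - j) * c) * (y' - z')) * i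
          + (y + j * z + (m - j) * c) * (y' + j * z' + (m - j) * c') by ring), sum_range_cubic]
    ring
  rw [Finset.sum_congr rfl (fun j _ => inner j)]
  rw [Finset.sum_congr rfl (fun (j : ℕ) _ =>
    show _ =
      ((y - z) * (y' - z') / 3 + ((y - z) * (z' - c') + (z - c) * (y' - z')) / 2
        + (z - c) * (z' - c')) * (j : ℝ) ^ 3
      + (-((y - z) * (y' - z')) / 2
        + ((y - z) * (y' + m * c') + (y + m * c) * (y' - z')) / 2
        - ((y - z) * (z' - c') + (z - c) * (y' - z')) / 2
        + ((z - c) * (y' + m * c') + (y + m * c) * (z' - c'))) * (j : ℝ) ^ 2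
      + ((y - z) * (y' - z') / 6 - ((y - z) * (y' + m * c') + (y + m * c) * (y' - z')) / 2
        + (y + m * c) * (y' + m * c')) * j + 0 by ring), sum_range_cubic, cast_choose_three,
    cast_choose_four]
  push_cast
  ring

end PowerSums

/-! ### Moments of the cells of vertices, edges and triangles -/

section CellSums

variable {V : Type*} [AddCommGroup V] [Module ℝ V]

theorem cell_singleton (n : ℕ) (hn : n ≠ 0) (v : V) : cell n {v} = {(n : ℝ) • v} := by
  ext x
  simp only [cell, Finset.mem_singleton, forall_eq, Finset.sum_singleton, Set.mem_ofPred_eq,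
    Set.mem_singleton_iff]
  constructor
  · rintro ⟨k, -, rfl, rfl⟩; rfl
  · rintro rfl
    exact ⟨fun _ => n, Nat.pos_of_ne_zero hn, rfl, rfl⟩

theorem cell_pair (m : ℕ) {y z : V} (h : y ≠ z) [DecidableEq V] : cell (m + 1) {y, z} =
    (fun i : ℕ => ((i : ℝ) + 1) • y + ((m : ℝ) - i) • z) '' (Finset.range m : Set ℕ) := by
  ext x
  simp only [cell, Set.mem_ofPred_eq, Set.mem_image, Finset.coe_range, Set.mem_Iio,
    Finset.sum_pair h, Finset.mem_insert, Finset.mem_singleton, forall_eq_or_imp, forall_eq]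
  constructor
  · rintro ⟨k, ⟨hy, hz⟩, hk, rfl⟩
    refine ⟨k y - 1, by omega, ?_⟩
    have h1 : ((k y - 1 : ℕ) : ℝ) = k y - 1 := by rw [Nat.cast_sub hy]; simp
    have h2 : (k y : ℝ) + k z = m + 1 := by exact_mod_cast hk
    rw [h1]
    congr 2
    · ring
    · linarith
  · rintro ⟨i, hi, rfl⟩
    refine ⟨fun v => if v = y then i + 1 else m - i, ⟨by simp, ?_⟩, ?_, ?_⟩
    · simp only [h.symm, if_false]; omega
    · simp only [h.symm, if_false, if_true]; omega
    · simp only [h.symm, if_false, if_true]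
      rw [Nat.cast_sub hi.le]; simp

theorem cell_triple (m : ℕ) {y z c : V} (h : y ≠ z) (hy : y ≠ c) (hz : z ≠ c) [DecidableEq V] :
    cell (m + 1) {y, z, c} =
    (fun p : (_ : ℕ) × ℕ => ((p.2 : ℝ) + 1) • y + ((p.1 : ℝ) - p.2) • z + ((m : ℝ) - p.1) • c) ''
      ((Finset.range m).sigma Finset.range : Set ((_ : ℕ) × ℕ)) := by
  have hyn : y ∉ ({z, c} : Finset V) := by simp [h, hy]
  ext x
  simp only [cell, Set.mem_ofPred_eq, Set.mem_image, Finset.coe_sigma, Set.mem_sigma_iff,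
    Finset.coe_range, Set.mem_Iio, Finset.sum_insert hyn,
    Finset.sum_pair hz, Finset.mem_insert, Finset.mem_singleton, forall_eq_or_imp, forall_eq]
  constructor
  · rintro ⟨k, ⟨hky, hkz, hkc⟩, hk, rfl⟩
    -- The indices are partial sums of the weights, lowered by one because weights start at `1`.
    refine ⟨⟨k y + k z - 1, k y - 1⟩, ⟨by dsimp only; omega, by dsimp only; omega⟩, ?_⟩
    have h1 : ((k y - 1 : ℕ) : ℝ) = k y - 1 := by rw [Nat.cast_sub hky]; simp
    have h3 : ((k y + k z - 1 : ℕ) : ℝ) = k y + k z - 1 := by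
      rw [Nat.cast_sub (by omega)]; simp
    have h2 : (k y : ℝ) + (k z + k c) = m + 1 := by exact_mod_cast hk
    dsimp only
    rw [h1, h3, add_assoc]
    congr 2
    · ring
    · congr 1; ring
    · congr 1; linarith
  · rintro ⟨⟨j, i⟩, ⟨hj, hi⟩, rfl⟩
    dsimp only at hj hi
    refine ⟨fun v => if v = y then i + 1 else if v = z then j - i else m - j, ⟨by simp, ?_, ?_⟩,
      ?_, ?_⟩
    · simp only [h.symm, if_false, if_true]; omega
    · simp only [hy.symm, hz.symm, if_false]; omega
    · simp only [h.symm, hy.symm, hz.symm, if_false, if_true]; omega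
    · simp only [h.symm, hy.symm, hz.symm, if_false, if_true]
      rw [Nat.cast_sub hi.le, Nat.cast_sub hj.le]; simp [add_assoc]

theorem cell_finite {m : ℕ} {s : Finset V} (hs : s.card = 1 ∨ s.card = 2 ∨ s.card = 3) :
    (cell (m + 1) s).Finite := by
  classical
  rcases hs with h | h | h
  · obtain ⟨v, rfl⟩ := Finset.card_eq_one.1 h
    rw [cell_singleton _ (Nat.succ_ne_zero m)]
    exact Set.finite_singleton _
  · obtain ⟨y, z, hyz, rfl⟩ := Finset.card_eq_two.1 h
    rw [cell_pair m hyz]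
    exact (Finset.finite_toSet _).image _
  · obtain ⟨y, z, c, hyz, hy, hz, rfl⟩ := Finset.card_eq_three.1 h
    rw [cell_triple m hyz hy hz]
    exact (Finset.finite_toSet _).image _

variable (a b : V →ₗ[ℝ] ℝ)

theorem finsum_cell_singleton (m : ℕ) (v : V) :
    ∑ᶠ x ∈ cell (m + 1) {v}, a x * b x = ((m : ℝ) + 1) ^ 2 * (a v * b v) := by
  rw [cell_singleton _ (Nat.succ_ne_zero m), finsum_mem_singleton]
  simp only [map_smul, smul_eq_mul]
  push_cast
  ring

theorem finsum_cell_pair (m : ℕ) {s : Finset V} (hs : AffineIndependent ℝ ((↑) : s → V))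
    (hc : s.card = 2) :
    ∑ᶠ x ∈ cell (m + 1) s, a x * b x = ((m + 1).choose 3 : ℝ) * ∑ v ∈ s, a v * b v
      + ((m + 2).choose 3 : ℝ) * (a (∑ v ∈ s, v) * b (∑ v ∈ s, v)) := by
  classical
  obtain ⟨y, z, h, rfl⟩ := Finset.card_eq_two.1 hc
  rw [cell_pair m h, finsum_mem_image, finsum_mem_coe_finset, Finset.sum_pair h, Finset.sum_pair h,
    map_add, map_add, ← sum_range_edge]
  · simp only [map_add, map_smul, smul_eq_mul]
  · intro i _ j _ hij
    have := weights_unique hs (a := fun v => if v = y then (i : ℝ) + 1 else m - i)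
      (b := fun v => if v = y then (j : ℝ) + 1 else m - j)
      (by simp only [Finset.sum_pair h, h.symm, if_true, if_false]; ring)
      (by simpa only [Finset.sum_pair h, h.symm, if_true, if_false] using hij) y (by simp)
    simpa using this

theorem finsum_cell_triple (m : ℕ) {s : Finset V} (hs : AffineIndependent ℝ ((↑) : s → V))
    (hc : s.card = 3) :
    ∑ᶠ x ∈ cell (m + 1) s, a x * b x =
      ((m + 2).choose 4 : ℝ) * ∑ e ∈ s.powersetCard 2, a (∑ v ∈ e, v) * b (∑ v ∈ e, v)
        - ((m + 1).choose 3 : ℝ) * ∑ v ∈ s, a v * b v := by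
  classical
  obtain ⟨y, z, c, h, hy, hz, rfl⟩ := Finset.card_eq_three.1 hc
  have hyn : y ∉ ({z, c} : Finset V) := by simp [h, hy]
  have hp : ({y, z, c} : Finset V).powersetCard 2 = {{y, z}, {y, c}, {z, c}} := by
    ext e
    rw [Finset.mem_powersetCard]
    simp only [Finset.mem_insert, Finset.mem_singleton]
    constructor
    · rintro ⟨he, hcard⟩
      obtain ⟨p, q, hpq, rfl⟩ := Finset.card_eq_two.1 hcard
      have h1 := he (Finset.mem_insert_self p {q})
      have h2 := he (Finset.mem_insert_of_mem (Finset.mem_singleton_self q))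
      simp only [Finset.mem_insert, Finset.mem_singleton] at h1 h2
      rcases h1 with rfl | rfl | rfl <;> rcases h2 with rfl | rfl | rfl <;>
        simp_all [Finset.pair_comm]
    · rintro (rfl | rfl | rfl)
      · exact ⟨by intro v; simp; tauto, Finset.card_pair h⟩
      · exact ⟨by intro v; simp; tauto, Finset.card_pair hy⟩
      · exact ⟨by intro v; simp; tauto, Finset.card_pair hz⟩
  have n1 : ({y, z} : Finset V) ∉ ({{y, c}, {z, c}} : Finset (Finset V)) := by
    intro hm
    rw [Finset.mem_insert, Finset.mem_singleton] at hm
    rcases hm with hm | hm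
    · have : z ∈ ({y, c} : Finset V) := hm ▸ by simp
      simp [h.symm, hz] at this
    · have : y ∈ ({z, c} : Finset V) := hm ▸ by simp
      exact hyn this
  have n2 : ({y, c} : Finset V) ≠ {z, c} := by
    intro hm
    have : y ∈ ({z, c} : Finset V) := hm ▸ by simp
    exact hyn this
  rw [hp, Finset.sum_insert n1, Finset.sum_pair n2, Finset.sum_pair h, Finset.sum_pair hy,
    Finset.sum_pair hz, Finset.sum_insert hyn, Finset.sum_pair hz, cell_triple m h hy hz,
    finsum_mem_image, finsum_mem_coe_finset, Finset.sum_sigma]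
  · have := sum_range_triangle (a y) (a z) (a c) (b y) (b z) (b c) m
    simp only [map_add, map_smul, smul_eq_mul]
    rw [this]
    ring
  · rintro ⟨j, i⟩ _ ⟨j', i'⟩ _ hij
    have key := weights_unique hs
      (a := fun v => if v = y then (i : ℝ) + 1 else if v = z then (j : ℝ) - i else m - j)
      (b := fun v => if v = y then (i' : ℝ) + 1 else if v = z then (j' : ℝ) - i' else m - j')
      (by
        simp only [Finset.sum_insert hyn, Finset.sum_pair hz, h.symm, hy.symm, hz.symm, if_true,
          if_false]
        ring)
      (by
        simpa only [Finset.sum_insert hyn, Finset.sum_pair hz, h.symm, hy.symm, hz.symm, if_true,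
          if_false, add_assoc] using hij)
    have k1 := key y (by simp)
    have k2 := key c (by simp)
    simp only [hy.symm, hz.symm, if_true, if_false, add_left_inj, sub_right_inj, Nat.cast_inj]
      at k1 k2
    rw [k1, k2]

end CellSums

/-! ### Local structure of a planar triangulation -/

section Planar

variable {V : Type*} [NormedAddCommGroup V] [NormedSpace ℝ V]

/-- The area form `X ∧ Y` of two coordinate functionals. -/
def wedge (X Y : V →ₗ[ℝ] ℝ) (a : V) : V →ₗ[ℝ] ℝ := X a • Y - Y a • X

theorem wedge_apply (X Y : V →ₗ[ℝ] ℝ) (a b : V) : wedge X Y a b = X a * Y b - Y a * X b := by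
  simp [wedge]

/-- A finite triangulation `K` of a convex set `P`, together with linear functionals `X`, `Y` that
restrict to coordinates on the direction of the affine span of `P`, which is therefore a plane. -/
structure IsPlanarTriangulation (P : Set V) (K : Geometry.SimplicialComplex ℝ V)
    (X Y : V →ₗ[ℝ] ℝ) : Prop where
  finite : K.faces.Finite
  space_eq : K.space = P
  convex : Convex ℝ P
  inj : ∀ w ∈ vectorSpan ℝ P, X w = 0 → Y w = 0 → w = 0
  surj : ∀ s t : ℝ, ∃ w ∈ vectorSpan ℝ P, X w = s ∧ Y w = t

namespace IsPlanarTriangulation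

variable {P : Set V} {K : Geometry.SimplicialComplex ℝ V} {X Y : V →ₗ[ℝ] ℝ}

theorem mem_of_mem_face (h : IsPlanarTriangulation P K X Y)
    {s : Finset V} (hs : s ∈ K.faces) {v : V} (hv : v ∈ s) : v ∈ P :=
  h.space_eq ▸ Geometry.SimplicialComplex.subset_space hs hv

theorem direction_mem {p q : V} (hp : p ∈ P) (hq : q ∈ P) : p - q ∈ vectorSpan ℝ P :=
  vsub_mem_vectorSpan ℝ hp hq

/-- Every functional agrees on the plane of `P` with a combination of the coordinates. -/
theorem exists_coeff (h : IsPlanarTriangulation P K X Y)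
    (f : V →ₗ[ℝ] ℝ) :
    ∃ A B : ℝ, ∀ w ∈ vectorSpan ℝ P, f w = A * X w + B * Y w := by
  obtain ⟨e₁, h₁, hX₁, hY₁⟩ := h.surj 1 0
  obtain ⟨e₂, h₂, hX₂, hY₂⟩ := h.surj 0 1
  refine ⟨f e₁, f e₂, fun w hw => ?_⟩
  have := h.inj (w - X w • e₁ - Y w • e₂)
    (Submodule.sub_mem _ (Submodule.sub_mem _ hw (Submodule.smul_mem _ _ h₁))
      (Submodule.smul_mem _ _ h₂)) (by simp [hX₁, hX₂]) (by simp [hY₁, hY₂])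
  have h2 := congrArg f this
  simp only [map_sub, map_smul, smul_eq_mul, map_zero] at h2
  linarith

theorem sq_add_sq_pos (h : IsPlanarTriangulation P K X Y)
    {u : V} (hu : u ∈ vectorSpan ℝ P) (hu0 : u ≠ 0) :
    0 < X u ^ 2 + Y u ^ 2 := by
  by_contra hn
  refine hu0 (h.inj u hu ?_ ?_) <;> nlinarith [sq_nonneg (X u), sq_nonneg (Y u)]

theorem exists_wedge_ne_zero (h : IsPlanarTriangulation P K X Y)
    {u y : V} (hu : u ∈ vectorSpan ℝ P) (hu0 : u ≠ 0) (hy : y ∈ P) :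
    ∃ p ∈ P, wedge X Y u (p - y) ≠ 0 := by
  by_contra! hn
  have hle : vectorSpan ℝ P ≤ LinearMap.ker (wedge X Y u) := by
    rw [vectorSpan_eq_span_vsub_set_right ℝ hy, Submodule.span_le]
    rintro _ ⟨p, hp, rfl⟩
    exact hn p hp
  -- Rotating `u` by a right angle gives a vector of the plane with area form `X u ^ 2 + Y u ^ 2`
  -- against `u`.
  obtain ⟨w, hw, hXw, hYw⟩ := h.surj (-Y u) (X u)
  have h0 : wedge X Y u w = 0 := hle hw
  rw [wedge_apply, hXw, hYw] at h0
  have := h.sq_add_sq_pos hu hu0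
  nlinarith

theorem eq_smul_of_wedge_eq_zero (h : IsPlanarTriangulation P K X Y)
    {u w : V} (hu : u ∈ vectorSpan ℝ P) (hw : w ∈ vectorSpan ℝ P)
    (hu0 : u ≠ 0) (h0 : wedge X Y u w = 0) : ∃ l : ℝ, w = l • u := by
  have hpos := h.sq_add_sq_pos hu hu0
  rw [wedge_apply] at h0
  -- The coefficient of the orthogonal projection of `w` to `u` in the coordinates `X`, `Y`.
  refine ⟨(X u * X w + Y u * Y w) / (X u ^ 2 + Y u ^ 2), sub_eq_zero.1 (h.inj _
    (Submodule.sub_mem _ hw (Submodule.smul_mem _ _ hu)) ?_ ?_)⟩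
  · rw [map_sub, map_smul, smul_eq_mul]
    field_simp
    linear_combination (-Y u) * h0
  · rw [map_sub, map_smul, smul_eq_mul]
    field_simp
    linear_combination (X u) * h0

/-- Near `x`, the segment from `x` to `p` runs in a single face. -/
theorem exists_face_along (h : IsPlanarTriangulation P K X Y)
    {x p : V} (hx : x ∈ P) (hp : p ∈ P) :
    ∃ s ∈ K.faces, x ∈ convexHull ℝ (s : Set V) ∧
      ∃ ε : ℝ, 0 < ε ∧ x + ε • (p - x) ∈ convexHull ℝ (s : Set V) := by
  have hmem : ∀ n : ℕ, ∃ s : K.faces,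
      x + (1 / ((n : ℝ) + 1)) • (p - x) ∈ convexHull ℝ ((s : Finset V) : Set V) := by
    intro n
    have : x + (1 / ((n : ℝ) + 1)) • (p - x) ∈ P := by
      refine h.convex.add_smul_sub_mem hx hp ⟨by positivity, ?_⟩
      rw [div_le_one (by positivity)]
      linarith [n.cast_nonneg (α := ℝ)]
    rw [← h.space_eq, Geometry.SimplicialComplex.mem_space_iff] at this
    obtain ⟨s, hs, hxs⟩ := this
    exact ⟨⟨s, hs⟩, hxs⟩
  choose s hs using hmem
  have : Finite K.faces := h.finite
  -- By pigeonhole one face contains infinitely many of the points tending to `x`, and being closed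
  -- it contains `x` as well.
  obtain ⟨t, ht⟩ := Finite.exists_infinite_fiber s
  have ht' := Nat.frequently_atTop_iff_infinite.2 (Set.infinite_coe_iff.1 ht)
  have htend : Filter.Tendsto (fun n : ℕ => x + (1 / ((n : ℝ) + 1)) • (p - x)) Filter.atTop
      (nhds (x + (0 : ℝ) • (p - x))) :=
    ((tendsto_one_div_add_atTop_nhds_zero_nat (𝕜 := ℝ)).smul_const _).const_add _
  rw [zero_smul, add_zero] at htend
  have hfreq : ∃ᶠ n : ℕ in Filter.atTop,
      x + (1 / ((n : ℝ) + 1)) • (p - x) ∈ convexHull ℝ ((t : Finset V) : Set V) :=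
    ht'.mono fun n hn => by
      have hn : s n = t := hn
      exact hn ▸ hs n
  refine ⟨t, t.2, ?_, ?_⟩
  · exact ((Finset.finite_toSet _).isClosed_convexHull ℝ).mem_of_frequently_of_tendsto hfreq htend
  · obtain ⟨n, hn⟩ := hfreq.exists
    exact ⟨_, by positivity, hn⟩

variable [DecidableEq V]

theorem face_pair {v z : V} {s : Finset V} (hs : s ∈ K.faces) (hv : v ∈ s) (hz : z ∈ s) :
    {v, z} ∈ K.faces :=
  K.down_closed hs (by intro; simp; rintro (rfl | rfl) <;> assumption) (by simp)

/-- A face followed from the midpoint of the edge towards `p` contains the whole edge, since the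
midpoint is in the edge's relative interior. It also has a vertex strictly on the left, as it
reaches points there. -/
theorem exists_left_triangle (h : IsPlanarTriangulation P K X Y)
    {y z p : V} (hyz : y ≠ z) (he : {y, z} ∈ K.faces) (hp : p ∈ P)
    (hw : 0 < wedge X Y (z - y) (p - y)) :
    ∃ c, {y, z, c} ∈ K.faces ∧ 0 < wedge X Y (z - y) (c - y) := by
  have hy : y ∈ P := h.mem_of_mem_face he (by simp)
  have hz : z ∈ P := h.mem_of_mem_face he (by simp)
  have hm : (1 / 2 : ℝ) • y + (1 / 2 : ℝ) • z ∈ P :=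
    h.convex hy hz (by norm_num) (by norm_num) (by norm_num)
  obtain ⟨s, hs, hms, ε, hε, hq⟩ := h.exists_face_along hm hp
  have hsub : {y, z} ⊆ s := by
    refine subset_of_pos_weights_of_mem_face he hs (w := fun _ => 1 / 2) (by norm_num) ?_ ?_
    · rw [Finset.sum_pair hyz]; norm_num
    · rw [Finset.sum_pair hyz]; exact hms
  have hself : wedge X Y (z - y) z = wedge X Y (z - y) y := by
    simp only [wedge_apply, map_sub]; ring
  have : ∃ c ∈ s, 0 < wedge X Y (z - y) (c - y) := by
    by_contra! hn
    have hcon : convexHull ℝ (s : Set V) ⊆ {x | wedge X Y (z - y) x ≤ wedge X Y (z - y) y} :=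
      convexHull_min (fun c hc => by simpa [sub_nonpos] using hn c hc)
        (convex_halfSpace_le (wedge X Y (z - y)).isLinear _)
    have h1 : wedge X Y (z - y) _ ≤ wedge X Y (z - y) y := hcon hq
    rw [map_sub (wedge X Y (z - y))] at hw
    rw [map_add, map_smul, map_sub (wedge X Y (z - y)), map_add, map_smul, map_smul, hself] at h1
    simp only [smul_eq_mul] at h1
    nlinarith
  obtain ⟨c, hc, hpos⟩ := this
  refine ⟨c, K.down_closed hs ?_ (by simp), hpos⟩
  intro v hv
  simp only [Finset.mem_insert, Finset.mem_singleton] at hv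
  rcases hv with rfl | rfl | rfl
  · exact hsub (by simp)
  · exact hsub (by simp)
  · exact hc

/-- Two triangles on the same side of an edge overlap near its midpoint: some point there is in the
relative interior of `{y, z, c'}` and also in the triangle `{y, z, c}`, so the first face is
contained in the second. -/
theorem left_triangle_unique (h : IsPlanarTriangulation P K X Y)
    {y z c c' : V} (hc : {y, z, c} ∈ K.faces)
    (hc' : {y, z, c'} ∈ K.faces) (hw : 0 < wedge X Y (z - y) (c - y))
    (hw' : 0 < wedge X Y (z - y) (c' - y)) : c' = c := by
  have hy : y ∈ P := h.mem_of_mem_face hc (by simp)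
  have hz : z ∈ P := h.mem_of_mem_face hc (by simp)
  have hcP : c ∈ P := h.mem_of_mem_face hc (by simp)
  have hcP' : c' ∈ P := h.mem_of_mem_face hc' (by simp)
  have hyz : y ≠ z := by rintro rfl; simp [wedge_apply] at hw
  have hyc : y ≠ c' := by rintro rfl; simp [wedge_apply] at hw'
  have hzc : z ≠ c' := by
    rintro rfl
    rw [wedge_apply] at hw'
    nlinarith
  have hyn : y ∉ ({z, c'} : Finset V) := by simp [hyz, hyc]
  set D := wedge X Y (z - y) (c - y) with hD
  -- Cramer's rule for `c' - y` in the basis `z - y`, `c - y`.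
  set β := wedge X Y (z - y) (c' - y) / D with hβ
  set α := wedge X Y (c' - y) (c - y) / D with hα
  have hβ0 : 0 < β := by positivity
  have hdec : c' - y = α • (z - y) + β • (c - y) := by
    rw [← sub_eq_zero]
    apply h.inj
    · exact Submodule.sub_mem _ (direction_mem hcP' hy) (Submodule.add_mem _
        (Submodule.smul_mem _ _ (direction_mem hz hy)) (Submodule.smul_mem _ _ (direction_mem hcP hy)))
    · rw [map_sub, map_add, map_smul, map_smul, smul_eq_mul, smul_eq_mul, hα, hβ]
      field_simp
      simp only [hD, wedge_apply]
      ring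
    · rw [map_sub, map_add, map_smul, map_smul, smul_eq_mul, smul_eq_mul, hα, hβ]
      field_simp
      simp only [hD, wedge_apply]
      ring
  -- The bounds on `ε` keep the weights of the test point positive for `y, z, c'` and nonnegative
  -- for `y, z, c`.
  obtain ⟨ε, hε, hε1, hε2⟩ : ∃ ε : ℝ, 0 < ε ∧ ε < 1 / 2 ∧ ε * (|α| + β) < 1 / 2 := by
    have hS : 0 < 4 * (1 + |α| + β) := by positivity
    refine ⟨1 / (4 * (1 + |α| + β)), by positivity, ?_, ?_⟩
    · rw [div_lt_div_iff₀ hS (by norm_num)]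
      nlinarith [abs_nonneg α]
    · rw [div_mul_eq_mul_div, div_lt_div_iff₀ hS (by norm_num)]
      nlinarith [abs_nonneg α]
  have hα1 : |ε * α| = ε * |α| := by rw [abs_mul, abs_of_pos hε]
  have hα2 := neg_abs_le (ε * α)
  have hα3 := le_abs_self (ε * α)
  have hεβ : 0 < ε * β := by positivity
  have hsub : ({y, z, c'} : Finset V) ⊆ {y, z, c} := by
    refine subset_of_pos_weights_of_mem_face hc' hc
      (w := fun v => if v = y then 1 / 2 - ε else if v = z then 1 / 2 else ε) ?_ ?_ ?_
    · intro v _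
      split_ifs <;> linarith
    · simp only [Finset.sum_insert hyn, Finset.sum_pair hzc, hyz.symm, hyc.symm, hzc.symm, if_true,
        if_false]
      ring
    · simp only [Finset.sum_insert hyn, Finset.sum_pair hzc, hyz.symm, hyc.symm, hzc.symm, if_true,
        if_false]
      have hq : (1 / 2 - ε) • y + ((1 / 2 : ℝ) • z + ε • c') =
          (1 / 2 - ε * α - ε * β) • y + (1 / 2 + ε * α) • z + (ε * β) • c := by
        have : c' = y + (α • (z - y) + β • (c - y)) := by rw [← hdec]; abel
        rw [this]
        module
      rw [hq]
      refine (convex_convexHull ℝ _).sum_mem (t := Finset.univ (α := Fin 3))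
        (w := ![1 / 2 - ε * α - ε * β, 1 / 2 + ε * α, ε * β]) (z := ![y, z, c]) ?_ ?_ ?_ |> fun H =>
          by simpa [Fin.sum_univ_three] using H
      · intro i _
        fin_cases i <;> simp <;> nlinarith
      · simp only [Fin.sum_univ_three, Matrix.cons_val]
        ring
      · intro i _
        apply subset_convexHull
        fin_cases i <;> simp
  have : c' ∈ ({y, z, c} : Finset V) := hsub (by simp)
  simpa [hyc.symm, hzc.symm] using this

/-- Zero area would make `c` an affine combination of `y` and `z`, against affine independence of
the face. -/
theorem wedge_ne_zero_of_face (h : IsPlanarTriangulation P K X Y)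
    {y z c : V} (hc : {y, z, c} ∈ K.faces) (hyz : y ≠ z) (hyc : y ≠ c)
    (hzc : z ≠ c) : wedge X Y (z - y) (c - y) ≠ 0 := by
  intro h0
  have hy : y ∈ P := h.mem_of_mem_face hc (by simp)
  have hyn : y ∉ ({z, c} : Finset V) := by simp [hyz, hyc]
  obtain ⟨l, hl⟩ := h.eq_smul_of_wedge_eq_zero
    (direction_mem (h.mem_of_mem_face hc (by simp)) hy) (direction_mem (h.mem_of_mem_face hc (by simp)) hy)
    (sub_ne_zero.2 hyz.symm) h0
  have hcl : c = y + l • (z - y) := by rw [← hl]; abel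
  have := weights_unique (K.indep hc) (a := fun v => if v = c then 1 else 0)
    (b := fun v => if v = y then 1 - l else if v = z then l else 0)
    (by simp [Finset.sum_insert hyn, Finset.sum_pair hzc, hyz.symm, hyc, hyc.symm, hzc, hzc.symm])
    (by
      simp only [Finset.sum_insert hyn, Finset.sum_pair hzc, hyz.symm, hyc, hyc.symm, hzc, hzc.symm,
        if_true, if_false]
      rw [zero_smul, zero_smul, one_smul, zero_smul]
      nth_rewrite 1 [hcl]
      module) c (by simp)
  simp [hyc.symm, hzc.symm] at this

/-- Distinct edges at `v` on the same line point in opposite directions. -/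
theorem exists_neg_smul_of_wedge_eq_zero (h : IsPlanarTriangulation P K X Y)
    {v z z' : V} (hz : {v, z} ∈ K.faces)
    (hz' : {v, z'} ∈ K.faces) (hvz : z ≠ v) (hvz' : z' ≠ v) (hne : z ≠ z')
    (h0 : wedge X Y (z - v) (z' - v) = 0) : ∃ l : ℝ, l < 0 ∧ z' - v = l • (z - v) := by
  have hv : v ∈ P := h.mem_of_mem_face hz (by simp)
  obtain ⟨l, hl⟩ := h.eq_smul_of_wedge_eq_zero
    (direction_mem (h.mem_of_mem_face hz (by simp)) hv) (direction_mem (h.mem_of_mem_face hz' (by simp)) hv)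
    (sub_ne_zero.2 hvz) h0
  refine ⟨l, ?_, hl⟩
  -- If `0 ≤ l ≤ 1`, the vertex `z'` lies on the edge `{v, z}` and so is one of its endpoints. For
  -- `l ≥ 1` the roles are exchanged, with factor `l⁻¹`.
  have key : ∀ {z z' : V} {l : ℝ}, {v, z} ∈ K.faces → {v, z'} ∈ K.faces → z' ≠ v → 0 ≤ l → l ≤ 1 →
      z' - v = l • (z - v) → z = z' := by
    intro z z' l hz hz' hvz' hl0 hl1 hl
    have hmem : z' ∈ convexHull ℝ (({v, z} : Finset V) : Set V) := by
      have : z' = v + l • (z - v) := by rw [← hl]; abel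
      rw [this]
      exact (convex_convexHull ℝ _).add_smul_sub_mem (subset_convexHull ℝ _ (by simp))
        (subset_convexHull ℝ _ (by simp)) ⟨hl0, hl1⟩
    have hvert : z' ∈ K.vertices := K.down_closed hz' (by simp) (by simp)
    rw [Geometry.SimplicialComplex.vertex_mem_convexHull_iff hvert hz] at hmem
    simp only [Finset.mem_insert, Finset.mem_singleton, hvz', false_or] at hmem
    exact hmem.symm
  by_contra hl0
  push Not at hl0
  rcases le_total l 1 with hl1 | hl1
  · exact hne (key hz hz' hvz' hl0 hl1 hl)
  · have hlpos : 0 < l := by linarith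
    refine hne (key hz' hz hvz (inv_nonneg.2 hl0) (inv_le_one_of_one_le₀ hl1) ?_).symm
    rw [hl, inv_smul_smul₀ hlpos.ne']

/-- `P` is not a single point, so a face followed from `v` towards another point of `P` has a second
vertex. -/
theorem exists_neighbor (h : IsPlanarTriangulation P K X Y)
    {v : V} (hv : v ∈ K.vertices) : ∃ z, z ≠ v ∧ {v, z} ∈ K.faces := by
  have hvP : v ∈ P := h.mem_of_mem_face hv (by simp)
  obtain ⟨e, he, he1, -⟩ := h.surj 1 0
  have he0 : e ≠ 0 := by rintro rfl; simp at he1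
  obtain ⟨p, hp, hpw⟩ := h.exists_wedge_ne_zero he he0 hvP
  have hpv : p - v ≠ 0 := by intro h0; simp [h0] at hpw
  obtain ⟨s, hs, hvs, ε, hε, hq⟩ := h.exists_face_along hvP hp
  rw [Geometry.SimplicialComplex.vertex_mem_convexHull_iff hv hs] at hvs
  by_contra! hn
  have hsv : s = {v} := Finset.eq_singleton_iff_unique_mem.2 ⟨hvs, fun z hz => by
    by_contra hzv
    exact hn z hzv (face_pair hs hvs hz)⟩
  rw [hsv, Finset.coe_singleton, convexHull_singleton, Set.mem_singleton_iff,
    add_eq_left, smul_eq_zero] at hq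
  exact hq.elim hε.ne' hpv

end IsPlanarTriangulation

end Planar

/-! ### Edges at a vertex and triangles at an edge -/

section Counting

variable {V : Type*} [NormedAddCommGroup V] [NormedSpace ℝ V]

/-- A strictly monotone substitute for the angle of a vector in the upper half-plane. -/
theorem pseudoAngle_lt {x₁ y₁ x₂ y₂ : ℝ} (h₁ : 0 ≤ y₁) (h₂ : 0 ≤ y₂)
    (h : 0 < x₁ * y₂ - y₁ * x₂) : x₂ / (|x₂| + y₂) < x₁ / (|x₁| + y₁) := by
  have p₁ : 0 < |x₁| + y₁ := by
    rcases eq_or_ne x₁ 0 with rfl | hx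
    · rcases h₁.eq_or_lt with rfl | hy
      · simp at h
      · positivity
    · positivity
  have p₂ : 0 < |x₂| + y₂ := by
    rcases eq_or_ne x₂ 0 with rfl | hx
    · rcases h₂.eq_or_lt with rfl | hy
      · simp at h
      · positivity
    · positivity
  rw [div_lt_div_iff₀ p₂ p₁]
  rcases le_total 0 x₁ with hx₁ | hx₁ <;> rcases le_total 0 x₂ with hx₂ | hx₂ <;>
    simp only [abs_of_nonneg, abs_of_nonpos, hx₁, hx₂] <;> nlinarith [mul_nonneg h₁ h₂]

namespace IsPlanarTriangulation

variable {P : Set V} {K : Geometry.SimplicialComplex ℝ V} {X Y : V →ₗ[ℝ] ℝ}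

theorem exists_wedge_pos_of_mem_intrinsicInterior (h : IsPlanarTriangulation P K X Y) {v z : V}
    (hv : v ∈ intrinsicInterior ℝ P) (hz : z ∈ P) (hzv : z ≠ v) :
    ∃ p ∈ P, 0 < wedge X Y (z - v) (p - v) := by
  by_contra! hn
  have hvP := intrinsicInterior_subset hv
  obtain ⟨p, hp, hpw⟩ := h.exists_wedge_ne_zero (direction_mem hz hvP) (sub_ne_zero.2 hzv) hvP
  apply hpw
  have := eq_of_mem_intrinsicInterior_of_le hv (-wedge X Y (z - v)) (fun q hq => by
    have := hn q hq
    rw [map_sub] at this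
    simp only [LinearMap.neg_apply]
    linarith) hp
  simp only [LinearMap.neg_apply, neg_inj] at this
  rw [map_sub, this, sub_self]

/-- At a vertex on the relative boundary there is exactly one edge having all of `P` to its
right. -/
theorem existsUnique_edge_right [FiniteDimensional ℝ V] [DecidableEq V]
    (h : IsPlanarTriangulation P K X Y) {v : V}
    (hv : v ∈ K.vertices) (hvi : v ∉ intrinsicInterior ℝ P) :
    ∃! z, (z ≠ v ∧ {v, z} ∈ K.faces) ∧ ¬ ∃ p ∈ P, 0 < wedge X Y (z - v) (p - v) := by
  have hvP : v ∈ P := h.mem_of_mem_face hv (by simp)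
  obtain ⟨f, hf, q, hq, hqf⟩ := exists_support_of_notMem_intrinsicInterior h.convex hvP hvi
  obtain ⟨A, B, hAB⟩ := h.exists_coeff f
  have hpos : 0 < A ^ 2 + B ^ 2 := by
    by_contra hn
    have hA : A = 0 := by nlinarith [sq_nonneg A, sq_nonneg B]
    have hB : B = 0 := by nlinarith [sq_nonneg A, sq_nonneg B]
    apply hqf
    have := hAB _ (direction_mem hq hvP)
    rw [hA, hB, map_sub] at this
    linarith
  have hfin : {z | z ≠ v ∧ {v, z} ∈ K.faces}.Finite := by
    refine (h.finite.biUnion fun s _ => s.finite_toSet).subset ?_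
    rintro z ⟨-, hz⟩
    exact Set.mem_biUnion hz (by simp)
  -- In the rotated coordinates `(B X - A Y, f)` all edges at `v` point into the upper half-plane,
  -- and the area form is multiplied by `A ^ 2 + B ^ 2`. Minimising the pseudo-angle picks the last
  -- edge counterclockwise; a point of `P` to its left would give a triangle with a later edge.
  obtain ⟨z, ⟨hzv, hz⟩, hmin⟩ := Set.exists_min_image _
    (fun z => (B * X (z - v) - A * Y (z - v)) / (|B * X (z - v) - A * Y (z - v)| + f (z - v)))
    hfin (h.exists_neighbor hv)
  have hz0 : ∀ {z}, z ∈ P → 0 ≤ f (z - v) := fun hz => by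
    rw [map_sub]; linarith [hf _ hz]
  have hn : ∀ p ∈ P, wedge X Y (z - v) (p - v) ≤ 0 := by
    intro p hp
    by_contra hpw
    obtain ⟨c, hc, hcw⟩ := h.exists_left_triangle hzv.symm hz hp (not_le.1 hpw)
    have hcv : c ≠ v := by rintro rfl; simp at hcw
    have hcP : c ∈ P := h.mem_of_mem_face hc (by simp)
    have hzP : z ∈ P := h.mem_of_mem_face hc (by simp)
    refine (hmin c ⟨hcv, face_pair hc (by simp) (by simp)⟩).not_gt
      (pseudoAngle_lt (hz0 hzP) (hz0 hcP) ?_)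
    rw [hAB _ (direction_mem hzP hvP), hAB _ (direction_mem hcP hvP)]
    rw [wedge_apply] at hcw
    nlinarith [mul_pos hpos hcw]
  refine ⟨z, ⟨⟨hzv, hz⟩, fun ⟨p, hp, hpw⟩ => (hn p hp).not_gt hpw⟩, ?_⟩
  · rintro z' ⟨⟨hzv', hz'⟩, hn'⟩
    by_contra hne
    push Not at hn'
    have hzP : z ∈ P := h.mem_of_mem_face hz (by simp)
    have hzP' : z' ∈ P := h.mem_of_mem_face hz' (by simp)
    -- Each of the two edges is weakly to the right of the other, so they are opposite on one line.
    -- `P` then lies on both sides of that line at once, hence on it.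
    have h0 : wedge X Y (z - v) (z' - v) = 0 := by
      have h1 := hn z' hzP'
      have h2 := hn' z hzP
      rw [wedge_apply] at h1 h2 ⊢
      linarith
    obtain ⟨l, hl, hlz⟩ := h.exists_neg_smul_of_wedge_eq_zero hz hz' hzv hzv' (Ne.symm hne) h0
    obtain ⟨p, hp, hpw⟩ :=
      h.exists_wedge_ne_zero (direction_mem hzP hvP) (sub_ne_zero.2 hzv) hvP
    have h1 := hn p hp
    have h2 := hn' p hp
    rw [hlz] at h2
    simp only [wedge_apply, map_smul, smul_eq_mul] at h1 h2 hpw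
    apply hpw
    nlinarith

/-- The number of edges at a vertex exceeds the number of triangles at it by one or zero,
according to whether the vertex is on the relative boundary. -/
theorem card_edges_at_vertex [FiniteDimensional ℝ V] [DecidableEq V]
    (h : IsPlanarTriangulation P K X Y) {v : V} (hv : v ∈ K.vertices)
    [Decidable (v ∈ intrinsicInterior ℝ P)] :
    (h.finite.toFinset.filter (fun e => e.card = 2 ∧ v ∈ e)).card =
      (h.finite.toFinset.filter (fun T => T.card = 3 ∧ v ∈ T)).card
        + if v ∈ intrinsicInterior ℝ P then 0 else 1 := by
  classical
  have hvP : v ∈ P := h.mem_of_mem_face hv (by simp)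
  let N : Finset V := (h.finite.toFinset.biUnion id).filter (fun z => z ≠ v ∧ {v, z} ∈ K.faces)
  have hN : ∀ z, z ∈ N ↔ z ≠ v ∧ {v, z} ∈ K.faces := by
    intro z
    simp only [N, Finset.mem_filter, Finset.mem_biUnion, Set.Finite.mem_toFinset, id,
      and_iff_right_iff_imp]
    exact fun hz => ⟨_, hz.2, by simp⟩
  let L : V → Prop := fun z => ∃ p ∈ P, 0 < wedge X Y (z - v) (p - v)
  have hE : N.card = (h.finite.toFinset.filter (fun e => e.card = 2 ∧ v ∈ e)).card := by
    refine Finset.card_bij (fun z _ => {v, z}) ?_ ?_ ?_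
    · intro z hz
      rw [hN] at hz
      simp [hz.2, Finset.card_pair hz.1.symm]
    · intro z hz z' hz' he
      rw [hN] at hz hz'
      have : z ∈ ({v, z'} : Finset V) := he ▸ by simp
      simpa [hz.1] using this
    · intro e he
      simp only [Finset.mem_filter, Set.Finite.mem_toFinset] at he
      obtain ⟨hef, hec, hve⟩ := he
      obtain ⟨y, z, hyz, rfl⟩ := Finset.card_eq_two.1 hec
      simp only [Finset.mem_insert, Finset.mem_singleton] at hve
      rcases hve with rfl | rfl
      · exact ⟨z, (hN z).2 ⟨hyz.symm, hef⟩, rfl⟩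
      · exact ⟨y, (hN y).2 ⟨hyz, Finset.pair_comm y v ▸ hef⟩, Finset.pair_comm _ _⟩
  have hL : ∀ z ∈ N.filter L, ∃ c, {v, z, c} ∈ K.faces ∧ 0 < wedge X Y (z - v) (c - v) := by
    intro z hz
    rw [Finset.mem_filter, hN] at hz
    obtain ⟨⟨hzv, hz⟩, p, hp, hpw⟩ := hz
    exact h.exists_left_triangle hzv.symm hz hp hpw
  choose c hc hcw using hL
  -- Each triangle at `v` lies to the left of exactly one of its two edges at `v`, so left triangles
  -- match the edges satisfying `L`. The remaining edges are counted by `hR`.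
  have hT : (N.filter L).card =
      (h.finite.toFinset.filter (fun T => T.card = 3 ∧ v ∈ T)).card := by
    refine Finset.card_bij (fun z hz => {v, z, c z hz}) ?_ ?_ ?_
    · intro z hz
      have hcw' := hcw z hz
      have hzv : z ≠ v := ((hN z).1 (Finset.mem_filter.1 hz).1).1
      have hcv : c z hz ≠ v := by intro he; simp [he] at hcw'
      have hcz : c z hz ≠ z := by
        intro he
        rw [he, wedge_apply] at hcw'
        linarith
      simp only [Finset.mem_filter, Set.Finite.mem_toFinset]
      exact ⟨hc z hz, Finset.card_eq_three.2 ⟨_, _, _, hzv.symm, hcv.symm, hcz.symm, rfl⟩,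
        by simp⟩
    · intro z hz z' hz' he
      by_contra hne
      have hzv : z ≠ v := ((hN z).1 (Finset.mem_filter.1 hz).1).1
      have hzv' : z' ≠ v := ((hN z').1 (Finset.mem_filter.1 hz').1).1
      have h1 : z ∈ ({v, z', c z' hz'} : Finset V) := by rw [← he]; simp
      have h2 : z' ∈ ({v, z, c z hz} : Finset V) := by rw [he]; simp
      simp only [Finset.mem_insert, Finset.mem_singleton, hzv, hzv', hne, Ne.symm hne, false_or]
        at h1 h2
      have h3 := hcw z hz
      have h4 := hcw z' hz'
      rw [← h2, wedge_apply] at h3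
      rw [← h1, wedge_apply] at h4
      linarith
    · intro T hT
      simp only [Finset.mem_filter, Set.Finite.mem_toFinset] at hT
      obtain ⟨hTf, hTc, hvT⟩ := hT
      have hcard : (T.erase v).card = 2 := by rw [Finset.card_erase_of_mem hvT, hTc]
      obtain ⟨y, z, hyz, hT⟩ := Finset.card_eq_two.1 hcard
      have hTe : T = {v, y, z} := by rw [← hT, Finset.insert_erase hvT]
      subst hTe
      have hvn : v ∉ ({y, z} : Finset V) := by rw [← hT]; simp
      simp only [Finset.mem_insert, Finset.mem_singleton, not_or] at hvn
      obtain ⟨hvy, hvz⟩ := hvn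
      have main : ∀ {y z : V}, v ≠ y → {v, y, z} ∈ K.faces → 0 < wedge X Y (y - v) (z - v) →
          ∃ a ha, ({v, a, c a ha} : Finset V) = {v, y, z} := by
        intro y z hvy hf hw
        have hy : y ∈ N.filter L := by
          rw [Finset.mem_filter, hN]
          exact ⟨⟨hvy.symm, face_pair hf (by simp) (by simp)⟩, z,
            h.mem_of_mem_face hf (by simp), hw⟩
        exact ⟨y, hy, by rw [h.left_triangle_unique hf (hc y hy) hw (hcw y hy)]⟩
      rcases (h.wedge_ne_zero_of_face hTf hvy hvz hyz).lt_or_gt with hw | hw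
      · have hcomm : ({v, y, z} : Finset V) = {v, z, y} := by rw [Finset.pair_comm y z]
        rw [hcomm] at hTf ⊢
        refine main hvz hTf ?_
        rw [wedge_apply] at hw ⊢
        linarith
      · exact main hvy hTf hw
  have hR : (N.filter (fun z => ¬ L z)).card = if v ∈ intrinsicInterior ℝ P then 0 else 1 := by
    split_ifs with hvi
    · rw [Finset.card_eq_zero, Finset.filter_eq_empty_iff]
      intro z hz hnL
      rw [hN] at hz
      exact hnL (h.exists_wedge_pos_of_mem_intrinsicInterior hvi
        (h.mem_of_mem_face hz.2 (by simp)) hz.1)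
    · obtain ⟨z, hz, huniq⟩ := h.existsUnique_edge_right hv hvi
      rw [Finset.card_eq_one]
      refine ⟨z, Finset.eq_singleton_iff_unique_mem.2 ⟨?_, fun z' hz' => huniq z' ?_⟩⟩
      · rw [Finset.mem_filter, hN]; exact hz
      · rwa [Finset.mem_filter, hN] at hz'
  rw [← hE, ← hT, ← hR, Finset.card_filter_add_card_filter_not]

/-- An open segment of `P` is not contained in the relative boundary iff `P` has points strictly on
both of its sides. -/
theorem not_openSegment_subset_intrinsicFrontier_iff [FiniteDimensional ℝ V]
    (h : IsPlanarTriangulation P K X Y) (hcl : IsClosed P) {y z : V} (hy : y ∈ P) (hz : z ∈ P)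
    (hyz : y ≠ z) :
    ¬ openSegment ℝ y z ⊆ intrinsicFrontier ℝ P ↔
      (∃ p ∈ P, 0 < wedge X Y (z - y) (p - y)) ∧ ∃ p ∈ P, wedge X Y (z - y) (p - y) < 0 := by
  have hdiff : intrinsicFrontier ℝ P = P \ intrinsicInterior ℝ P := by
    rw [← intrinsicClosure_sdiff_intrinsicInterior, intrinsicClosure_eq_closure, hcl.closure_eq]
  have hself : wedge X Y (z - y) z = wedge X Y (z - y) y := by
    simp only [wedge_apply, map_sub]; ring
  have hseg : ∀ x ∈ openSegment ℝ y z, wedge X Y (z - y) x = wedge X Y (z - y) y := by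
    rintro _ ⟨a, b, -, -, hab, rfl⟩
    rw [map_add, map_smul, map_smul, hself, ← add_smul, hab, one_smul]
  have hsub : openSegment ℝ y z ⊆ P := h.convex.openSegment_subset hy hz
  obtain ⟨r, hr, hrw⟩ := h.exists_wedge_ne_zero (direction_mem hz hy)
    (sub_ne_zero.2 hyz.symm) hy
  rw [← not_iff_not, not_not]
  constructor
  · rintro hfr ⟨⟨p, hp, hpw⟩, p', hp', hpw'⟩
    have hm : (1 / 2 : ℝ) • y + (1 / 2 : ℝ) • z ∈ openSegment ℝ y z :=
      ⟨1 / 2, 1 / 2, by norm_num, by norm_num, by norm_num, rfl⟩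
    have hmi := hfr hm
    rw [hdiff] at hmi
    obtain ⟨f, hf, q, hq, hqf⟩ := exists_support_of_notMem_intrinsicInterior h.convex hmi.1 hmi.2
    have hfy := hf y hy
    have hfz := hf z hz
    simp only [map_add, map_smul, smul_eq_mul] at hf hfy hfz hqf
    have hfyz : f z = f y := by linarith
    obtain ⟨A, B, hAB⟩ := h.exists_coeff f
    have hpos := h.sq_add_sq_pos (direction_mem hz hy) (sub_ne_zero.2 hyz.symm)
    have h0 := hAB _ (direction_mem hz hy)
    rw [map_sub, hfyz, sub_self] at h0
    set u := z - y with hu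
    -- As `f` vanishes on `u`, its increments are a fixed multiple of the area form with `u`. Points
    -- on both sides force that multiple to be zero, so `f` would be constant on `P`.
    have hprop : ∀ p ∈ P, (X u ^ 2 + Y u ^ 2) * (f p - f y) =
        (B * X u - A * Y u) * wedge X Y u (p - y) := by
      intro p hp
      have := hAB _ (direction_mem hp hy)
      rw [map_sub] at this
      rw [this, wedge_apply]
      linear_combination (-(X u * X (p - y) + Y u * Y (p - y))) * h0
    have hge : ∀ p ∈ P, 0 ≤ (B * X u - A * Y u) * wedge X Y u (p - y) := by
      intro p hp
      rw [← hprop p hp]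
      exact mul_nonneg hpos.le (by linarith [hf p hp])
    have hC : B * X u - A * Y u = 0 := by
      apply le_antisymm
      · by_contra hC
        nlinarith [hge p' hp']
      · by_contra hC
        nlinarith [hge p hp]
    have hq' := hprop q hq
    rw [hC, zero_mul] at hq'
    rcases mul_eq_zero.1 hq' with h1 | h1
    · exact hpos.ne' h1
    · apply hqf; linarith
  · intro hn x hx
    rw [hdiff]
    refine ⟨hsub hx, fun hxi => hrw ?_⟩
    rw [not_and_or] at hn
    have hw := hseg x hx
    rcases hn with hn | hn
    · push Not at hn
      have := eq_of_mem_intrinsicInterior_of_le hxi (-wedge X Y (z - y)) (fun p hp => by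
        have := hn p hp
        rw [map_sub] at this
        simp only [LinearMap.neg_apply]
        linarith) hr
      simp only [LinearMap.neg_apply, neg_inj] at this
      rw [map_sub, this, hw, sub_self]
    · push Not at hn
      have := eq_of_mem_intrinsicInterior_of_le hxi (wedge X Y (z - y)) (fun p hp => by
        have := hn p hp
        rw [map_sub] at this
        linarith) hr
      rw [map_sub, this, hw, sub_self]

/-- An edge with points of `P` strictly on both of its sides is contained in two triangles, and
any other edge is contained in one. -/
theorem card_triangles_at_edge [DecidableEq V] (h : IsPlanarTriangulation P K X Y) {y z : V}
    (he : {y, z} ∈ K.faces) (hyz : y ≠ z)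
    [Decidable ((∃ p ∈ P, 0 < wedge X Y (z - y) (p - y)) ∧
      ∃ p ∈ P, wedge X Y (z - y) (p - y) < 0)] :
    (h.finite.toFinset.filter (fun T => T.card = 3 ∧ {y, z} ⊆ T)).card =
      1 + if (∃ p ∈ P, 0 < wedge X Y (z - y) (p - y)) ∧
        ∃ p ∈ P, wedge X Y (z - y) (p - y) < 0 then 1 else 0 := by
  classical
  have hy : y ∈ P := h.mem_of_mem_face he (by simp)
  have hz : z ∈ P := h.mem_of_mem_face he (by simp)
  -- Reversing the edge exchanges its sides, so statements about the right follow from those about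
  -- the left.
  have hswap : ∀ p, wedge X Y (y - z) (p - z) = - wedge X Y (z - y) (p - y) := by
    intro p
    simp only [wedge_apply, map_sub]
    ring
  have hmem : ∀ T, T ∈ h.finite.toFinset.filter (fun T => T.card = 3 ∧ {y, z} ⊆ T) ↔
      ∃ c, {y, z, c} ∈ K.faces ∧ wedge X Y (z - y) (c - y) ≠ 0 ∧ T = {y, z, c} := by
    intro T
    simp only [Finset.mem_filter, Set.Finite.mem_toFinset]
    constructor
    · rintro ⟨hT, hc, hs⟩
      have hc1 : (T \ {y, z}).card = 1 := by
        rw [Finset.card_sdiff_of_subset hs, hc, Finset.card_pair hyz]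
      obtain ⟨c, hcT⟩ := Finset.card_eq_one.1 hc1
      have hT' : T = {y, z, c} := by
        rw [← Finset.union_sdiff_of_subset hs, hcT]
        ext; simp
      have hcn : c ∉ ({y, z} : Finset V) := by
        have : c ∈ T \ {y, z} := by simp [hcT]
        exact (Finset.mem_sdiff.1 this).2
      simp only [Finset.mem_insert, Finset.mem_singleton, not_or] at hcn
      subst hT'
      exact ⟨c, hT, h.wedge_ne_zero_of_face hT hyz (Ne.symm hcn.1) (Ne.symm hcn.2), rfl⟩
    · rintro ⟨c, hc, hw, rfl⟩
      refine ⟨hc, Finset.card_eq_three.2 ⟨y, z, c, hyz, ?_, ?_, rfl⟩, by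
        intro; simp; tauto⟩
      · rintro rfl; simp at hw
      · rintro rfl; apply hw; rw [wedge_apply]; ring
  have left : (∃ p ∈ P, 0 < wedge X Y (z - y) (p - y)) →
      ∃ c, {y, z, c} ∈ K.faces ∧ 0 < wedge X Y (z - y) (c - y) := by
    rintro ⟨p, hp, hw⟩
    exact h.exists_left_triangle hyz he hp hw
  have right : (∃ p ∈ P, wedge X Y (z - y) (p - y) < 0) →
      ∃ c, {y, z, c} ∈ K.faces ∧ wedge X Y (z - y) (c - y) < 0 := by
    rintro ⟨p, hp, hw⟩
    obtain ⟨c, hc, hcw⟩ := h.exists_left_triangle hyz.symm (Finset.pair_comm y z ▸ he) hp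
      (by rw [hswap]; linarith)
    rw [hswap] at hcw
    rw [Finset.insert_comm] at hc
    exact ⟨c, hc, by linarith⟩
  have left_unique : ∀ {c c'}, {y, z, c} ∈ K.faces → {y, z, c'} ∈ K.faces →
      0 < wedge X Y (z - y) (c - y) → 0 < wedge X Y (z - y) (c' - y) → c' = c :=
    fun hc hc' hw hw' => h.left_triangle_unique hc hc' hw hw'
  have right_unique : ∀ {c c'}, {y, z, c} ∈ K.faces → {y, z, c'} ∈ K.faces →
      wedge X Y (z - y) (c - y) < 0 → wedge X Y (z - y) (c' - y) < 0 → c' = c := by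
    intro c c' hc hc' hw hw'
    rw [Finset.insert_comm] at hc hc'
    exact h.left_triangle_unique hc hc' (by rw [hswap]; linarith) (by rw [hswap]; linarith)
  -- `P` is not contained in the line of the edge, which guarantees a triangle on at least one side.
  obtain ⟨r, hr, hrw⟩ := h.exists_wedge_ne_zero (direction_mem hz hy)
    (sub_ne_zero.2 hyz.symm) hy
  split_ifs with hint
  · obtain ⟨a, ha, haw⟩ := left hint.1
    obtain ⟨b, hb, hbw⟩ := right hint.2
    rw [Finset.card_eq_two]
    refine ⟨{y, z, a}, {y, z, b}, ?_, ?_⟩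
    · intro hab
      have hb' : b ∈ ({y, z, a} : Finset V) := by rw [hab]; simp
      simp only [Finset.mem_insert, Finset.mem_singleton] at hb'
      rcases hb' with rfl | rfl | rfl
      · simp at hbw
      · rw [wedge_apply] at hbw; linarith
      · linarith
    · ext T
      rw [hmem, Finset.mem_insert, Finset.mem_singleton]
      constructor
      · rintro ⟨c, hc, hw, rfl⟩
        rcases hw.lt_or_gt with hw | hw
        · exact Or.inr (by rw [right_unique hb hc hbw hw])
        · exact Or.inl (by rw [left_unique ha hc haw hw])
      · rintro (rfl | rfl)
        · exact ⟨a, ha, haw.ne', rfl⟩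
        · exact ⟨b, hb, hbw.ne, rfl⟩
  · rw [add_zero, Finset.card_eq_one]
    rcases hrw.lt_or_gt with hrw | hrw
    · obtain ⟨b, hb, hbw⟩ := right ⟨r, hr, hrw⟩
      refine ⟨{y, z, b}, ?_⟩
      ext T
      rw [hmem, Finset.mem_singleton]
      constructor
      · rintro ⟨c, hc, hw, rfl⟩
        rcases hw.lt_or_gt with hw | hw
        · rw [right_unique hb hc hbw hw]
        · exact (hint ⟨⟨c, h.mem_of_mem_face hc (by simp), hw⟩, r, hr, hrw⟩).elim
      · rintro rfl
        exact ⟨b, hb, hbw.ne, rfl⟩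
    · obtain ⟨a, ha, haw⟩ := left ⟨r, hr, hrw⟩
      refine ⟨{y, z, a}, ?_⟩
      ext T
      rw [hmem, Finset.mem_singleton]
      constructor
      · rintro ⟨c, hc, hw, rfl⟩
        rcases hw.lt_or_gt with hw | hw
        · exact (hint ⟨⟨r, hr, hrw⟩, c, h.mem_of_mem_face hc (by simp), hw⟩).elim
        · rw [left_unique ha hc haw hw]
      · rintro rfl
        exact ⟨a, ha, haw.ne', rfl⟩

end IsPlanarTriangulation

end Counting

/-! ### Assembly of the h²-tensor polynomial -/

section HTensorPolynomial

variable {d : ℕ} {P : Set (E d)} {K : Geometry.SimplicialComplex ℝ (E d)}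

/-- Coordinates of a basis of the two-dimensional direction space, extended to linear functionals on
the whole space. -/
theorem exists_isPlanarTriangulation (hP : IsLatticePolygon P)
    (hK : IsUnimodularTriangulation P K) : ∃ X Y, IsPlanarTriangulation P K X Y := by
  obtain ⟨⟨s, -, hs⟩, hdim⟩ := hP
  let b := Module.finBasisOfFinrankEq ℝ (vectorSpan ℝ P) hdim
  obtain ⟨X, hX⟩ := LinearMap.exists_extend (b.coord 0)
  obtain ⟨Y, hY⟩ := LinearMap.exists_extend (b.coord 1)
  have hX' : ∀ w : vectorSpan ℝ P, X w = b.repr w 0 := fun w => LinearMap.congr_fun hX w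
  have hY' : ∀ w : vectorSpan ℝ P, Y w = b.repr w 1 := fun w => LinearMap.congr_fun hY w
  refine ⟨X, Y, hK.finite, hK.space_eq, hs ▸ convex_convexHull ℝ _, ?_, ?_⟩
  · intro w hw hX0 hY0
    have : (⟨w, hw⟩ : vectorSpan ℝ P) = 0 := by
      rw [← b.repr.map_eq_zero_iff]
      ext i
      fin_cases i
      · exact (hX' ⟨w, hw⟩).symm.trans hX0
      · exact (hY' ⟨w, hw⟩).symm.trans hY0
    exact congrArg Subtype.val this
  · intro p q
    refine ⟨(p • b 0 + q • b 1 : vectorSpan ℝ P), Subtype.prop _, ?_, ?_⟩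
    · rw [hX']; simp
    · rw [hY']; simp

theorem card_face (hdim : dim P = 2) (hK : IsUnimodularTriangulation P K) {s : Finset (E d)}
    (hs : s ∈ K.faces) : s.card = 1 ∨ s.card = 2 ∨ s.card = 3 := by
  have h0 : 0 < s.card := (Geometry.SimplicialComplex.nonempty_of_mem_faces hs).card_pos
  have h1 := (K.indep hs).card_le_finrank_succ
  have h2 : Module.finrank ℝ (vectorSpan ℝ (Set.range ((↑) : s → E d))) ≤ dim P := by
    refine Submodule.finrank_mono (vectorSpan_mono ℝ ?_)
    rw [Subtype.range_coe_subtype]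
    exact hK.space_eq ▸ Geometry.SimplicialComplex.subset_space hs
  rw [Fintype.card_coe] at h1
  omega

theorem vertices_finite (hK : IsUnimodularTriangulation P K) : K.vertices.Finite :=
  hK.finite.preimage (Finset.singleton_injective.injOn)

theorem edges_finite (hK : IsUnimodularTriangulation P K) : (edges K).Finite :=
  hK.finite.subset fun _ he => he.1

theorem interiorEdges_finite (hK : IsUnimodularTriangulation P K) : (interiorEdges P K).Finite :=
  (edges_finite hK).subset fun _ he => he.1

theorem smul_inter_lattice_finite (hdim : dim P = 2) (hK : IsUnimodularTriangulation P K) (m : ℕ) :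
    ((((m + 1 : ℕ) : ℝ) • P) ∩ lattice d).Finite := by
  rw [smul_inter_lattice_eq_biUnion_cell hK m.succ_ne_zero]
  exact hK.finite.biUnion fun s hs => cell_finite (card_face hdim hK hs)

theorem mem_interiorEdges_pair {X Y : E d →ₗ[ℝ] ℝ} (h : IsPlanarTriangulation P K X Y)
    (hcl : IsClosed P) [DecidableEq (E d)] {y z : E d} (hyz : y ≠ z) (he : {y, z} ∈ K.faces) :
    {y, z} ∈ interiorEdges P K ↔
      (∃ p ∈ P, 0 < wedge X Y (z - y) (p - y)) ∧ ∃ p ∈ P, wedge X Y (z - y) (p - y) < 0 := by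
  rw [← h.not_openSegment_subset_intrinsicFrontier_iff hcl (h.mem_of_mem_face he (by simp))
    (h.mem_of_mem_face he (by simp)) hyz]
  constructor
  · rintro ⟨-, y', z', hyz', hset, hfr⟩
    rw [Finset.coe_pair, Set.pair_eq_pair_iff] at hset
    rcases hset with ⟨rfl, rfl⟩ | ⟨rfl, rfl⟩
    · exact hfr
    · rwa [openSegment_symm]
  · exact fun hfr => ⟨⟨he, Finset.card_pair hyz⟩, y, z, hyz, Finset.coe_pair, hfr⟩

theorem card_triangles_eq {X Y : E d →ₗ[ℝ] ℝ} (h : IsPlanarTriangulation P K X Y)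
    (hcl : IsClosed P) [DecidableEq (E d)] [DecidablePred (· ∈ interiorEdges P K)]
    {e : Finset (E d)} (he : e ∈ edges K) :
    (h.finite.toFinset.filter (fun T => T.card = 3 ∧ e ⊆ T)).card =
      1 + if e ∈ interiorEdges P K then 1 else 0 := by
  classical
  obtain ⟨he, hc⟩ := he
  obtain ⟨y, z, hyz, rfl⟩ := Finset.card_eq_two.1 hc
  rw [h.card_triangles_at_edge he hyz]
  simp only [mem_interiorEdges_pair h hcl hyz he]

theorem sum_by_card {M : Type*} [AddCommMonoid M] {α : Type*} (F : Finset (Finset α))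
    (hF : ∀ s ∈ F, s.card = 1 ∨ s.card = 2 ∨ s.card = 3) (g : Finset α → M) :
    ∑ s ∈ F, g s = ∑ s ∈ F with s.card = 1, g s + ∑ s ∈ F with s.card = 2, g s
      + ∑ s ∈ F with s.card = 3, g s := by
  rw [Finset.sum_filter, Finset.sum_filter, Finset.sum_filter, ← Finset.sum_add_distrib,
    ← Finset.sum_add_distrib]
  refine Finset.sum_congr rfl fun s hs => ?_
  rcases hF s hs with h | h | h <;> simp [h]

/-- The quadratic discrete moments of the dilates of `P` in terms of a unimodular
triangulation. -/
theorem finsum_smul_inter_lattice (hP : IsLatticePolygon P) (hK : IsUnimodularTriangulation P K)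
    (a b : E d →ₗ[ℝ] ℝ) (m : ℕ) :
    ∑ᶠ x ∈ (((m + 1 : ℕ) : ℝ) • P) ∩ lattice d, a x * b x =
      ((m : ℝ) + 1) ^ 2 * ∑ᶠ x ∈ P ∩ lattice d, a x * b x
      + ((m + 1).choose 3 : ℝ) * (∑ᶠ x ∈ P ∩ lattice d, a x * b x
          - ∑ᶠ x ∈ intrinsicInterior ℝ P ∩ lattice d, a x * b x)
      + ((m + 2).choose 3 : ℝ) * ∑ᶠ e ∈ edges K, a (∑ v ∈ e, v) * b (∑ v ∈ e, v)
      + ((m + 2).choose 4 : ℝ) * (∑ᶠ e ∈ edges K, a (∑ v ∈ e, v) * b (∑ v ∈ e, v)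
          + ∑ᶠ e ∈ interiorEdges P K, a (∑ v ∈ e, v) * b (∑ v ∈ e, v)) := by
  classical
  obtain ⟨X, Y, h⟩ := exists_isPlanarTriangulation hP hK
  obtain ⟨⟨s₀, -, hs₀⟩, hdim⟩ := hP
  have hcl : IsClosed P := hs₀ ▸ (Finset.finite_toSet s₀).isClosed_convexHull ℝ
  set F := h.finite.toFinset with hF
  have hFmem : ∀ s, s ∈ F ↔ s ∈ K.faces := fun s => by simp [hF]
  set Vt := (vertices_finite hK).toFinset with hVt
  have hVmem : ∀ v, v ∈ Vt ↔ v ∈ K.vertices := fun v => by simp [hVt]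
  have hcards : ∀ s ∈ F, s.card = 1 ∨ s.card = 2 ∨ s.card = 3 := fun s hs =>
    card_face hdim hK ((hFmem s).1 hs)
  set Q : E d → ℝ := fun x => a x * b x with hQ
  set R : Finset (E d) → ℝ := fun e => a (∑ v ∈ e, v) * b (∑ v ∈ e, v) with hR
  have eV : ∑ᶠ x ∈ P ∩ lattice d, Q x = ∑ v ∈ Vt, Q v := by
    rw [inter_lattice_eq_vertices hK, finsum_mem_eq_finite_toFinset_sum]
  have eVo : ∑ᶠ x ∈ intrinsicInterior ℝ P ∩ lattice d, Q x =
      ∑ v ∈ Vt, if v ∈ intrinsicInterior ℝ P then Q v else 0 := by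
    rw [← Finset.sum_filter, ← finsum_mem_coe_finset]
    refine finsum_mem_congr (Set.ext fun x => ?_) fun _ _ => rfl
    rw [Finset.coe_filter, Set.mem_inter_iff, Set.mem_ofPred_eq, hVmem,
      ← inter_lattice_eq_vertices hK, Set.mem_inter_iff]
    have := @intrinsicInterior_subset ℝ _ _ _ _ _ _ _ P x
    tauto
  have eE : ∑ᶠ e ∈ edges K, R e = ∑ e ∈ F with e.card = 2, R e := by
    rw [← finsum_mem_coe_finset]
    congr 2
    ext e
    simp [edges, hFmem]
  have eEo : ∑ᶠ e ∈ interiorEdges P K, R e =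
      ∑ e ∈ F with e.card = 2, if e ∈ interiorEdges P K then R e else 0 := by
    rw [← Finset.sum_filter, ← finsum_mem_coe_finset]
    refine finsum_mem_congr (Set.ext fun e => ?_) fun _ _ => rfl
    rw [Finset.filter_filter, Finset.coe_filter, Set.mem_ofPred_eq, hFmem]
    exact ⟨fun he => ⟨he.1.1, he.1.2, he⟩, fun he => he.2.2⟩
  have exchV : ∀ k : ℕ, ∑ s ∈ F with s.card = k, ∑ v ∈ s, Q v =
      ∑ v ∈ Vt, ((F.filter (fun s => s.card = k ∧ v ∈ s)).card : ℝ) * Q v := by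
    intro k
    rw [Finset.sum_comm' (t' := Vt) (s' := fun v => F.filter (fun s => s.card = k ∧ v ∈ s))]
    · simp [nsmul_eq_mul]
    · intro s v
      simp only [Finset.mem_filter, hVmem, hFmem]
      constructor
      · rintro ⟨⟨hs, hk⟩, hv⟩
        exact ⟨⟨hs, hk, hv⟩, K.down_closed hs (by simpa) (by simp)⟩
      · tauto
  -- Double counting of pairs of an edge and a triangle containing it; `exchV` does the same for
  -- vertices.
  have exchE : ∑ T ∈ F with T.card = 3, ∑ e ∈ T.powersetCard 2, R e =
      ∑ e ∈ F with e.card = 2, ((F.filter (fun T => T.card = 3 ∧ e ⊆ T)).card : ℝ) * R e := by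
    rw [Finset.sum_comm' (t' := F.filter (fun e => e.card = 2))
      (s' := fun e => F.filter (fun T => T.card = 3 ∧ e ⊆ T))]
    · simp [nsmul_eq_mul]
    · intro T e
      simp only [Finset.mem_filter, Finset.mem_powersetCard, hFmem]
      constructor
      · rintro ⟨⟨hT, hk⟩, he, he2⟩
        exact ⟨⟨hT, hk, he⟩, K.down_closed hT he (Finset.card_pos.1 (by omega)), he2⟩
      · tauto
  have e3 : ∑ T ∈ F with T.card = 3, ∑ e ∈ T.powersetCard 2, R e =
      ∑ᶠ e ∈ edges K, R e + ∑ᶠ e ∈ interiorEdges P K, R e := by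
    rw [exchE, eE, eEo, ← Finset.sum_add_distrib]
    refine Finset.sum_congr rfl fun e he => ?_
    rw [Finset.mem_filter, hFmem] at he
    rw [card_triangles_eq h hcl he]
    split_ifs <;> push_cast <;> ring
  have eV3 : ∑ s ∈ F with s.card = 2, ∑ v ∈ s, Q v - ∑ s ∈ F with s.card = 3, ∑ v ∈ s, Q v =
      ∑ᶠ x ∈ P ∩ lattice d, Q x - ∑ᶠ x ∈ intrinsicInterior ℝ P ∩ lattice d, Q x := by
    rw [exchV, exchV, eV, eVo, ← Finset.sum_sub_distrib, ← Finset.sum_sub_distrib]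
    refine Finset.sum_congr rfl fun v hv => ?_
    rw [h.card_edges_at_vertex ((hVmem v).1 hv)]
    split_ifs <;> push_cast <;> ring
  have e1 : ∑ s ∈ F with s.card = 1, ∑ᶠ x ∈ cell (m + 1) s, Q x =
      ((m : ℝ) + 1) ^ 2 * ∑ᶠ x ∈ P ∩ lattice d, Q x := by
    have : F.filter (fun s => s.card = 1) = Vt.image (fun v => {v}) := by
      ext s
      rw [Finset.mem_filter, Finset.mem_image, hFmem, Finset.card_eq_one]
      constructor
      · rintro ⟨hs, v, rfl⟩
        exact ⟨v, (hVmem v).2 hs, rfl⟩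
      · rintro ⟨v, hv, rfl⟩
        exact ⟨(hVmem v).1 hv, v, rfl⟩
    rw [this, Finset.sum_image Finset.singleton_injective.injOn, eV, Finset.mul_sum]
    exact Finset.sum_congr rfl fun v _ => finsum_cell_singleton a b m v
  rw [smul_inter_lattice_eq_biUnion_cell hK m.succ_ne_zero, finsum_mem_biUnion
    (fun s hs t ht hst => cell_disjoint m.succ_ne_zero hs ht hst) hK.finite
    (fun s hs => cell_finite (hcards s ((hFmem s).2 hs))),
    finsum_mem_eq_finite_toFinset_sum _ hK.finite, sum_by_card _ hcards, e1,
    Finset.sum_congr (s₁ := F.filter (fun s => s.card = 2)) rfl (fun s hs =>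
      finsum_cell_pair a b m (K.indep ((hFmem s).1 (Finset.mem_filter.1 hs).1))
        (Finset.mem_filter.1 hs).2),
    Finset.sum_congr (s₁ := F.filter (fun s => s.card = 3)) rfl (fun s hs =>
      finsum_cell_triple a b m (K.indep ((hFmem s).1 (Finset.mem_filter.1 hs).1))
        (Finset.mem_filter.1 hs).2),
    Finset.sum_add_distrib, Finset.sum_sub_distrib, ← Finset.mul_sum, ← Finset.mul_sum,
    ← Finset.mul_sum, ← Finset.mul_sum, e3, ← eV3, ← eE]
  ring

/-- Evaluation at `u` reduces tensor identities to real ones. Finiteness matters: a `finsum` with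
infinite support is `0` by default. -/
theorem finsum_tensorPow_apply {ι : Type*} {S : Set ι} (hS : S.Finite) (g : ι → E d)
    (u : Fin 2 → E d) :
    ((∑ᶠ i ∈ S, tensorPow 2 (g i) : SymTensor d 2) : MultilinearMap ℝ (fun _ : Fin 2 => E d) ℝ) u =
      ∑ᶠ i ∈ S, innerₛₗ ℝ (u 0) (g i) * innerₛₗ ℝ (u 1) (g i) := by
  rw [finsum_mem_eq_finite_toFinset_sum _ hS, finsum_mem_eq_finite_toFinset_sum _ hS,
    Submodule.coe_sum, sum_apply]
  refine Finset.sum_congr rfl fun i _ => ?_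
  rw [tensorPow_apply, Fin.prod_univ_two, innerₛₗ_apply_apply, innerₛₗ_apply_apply,
    real_inner_comm, real_inner_comm (u 1)]

/-- The discrete moment tensor of rank two of the dilates of `P`. -/
theorem discreteMoment_smul (hP : IsLatticePolygon P) (hK : IsUnimodularTriangulation P K)
    (m : ℕ) :
    discreteMoment 2 (((m + 1 : ℕ) : ℝ) • P) =
      ((m + 4).choose 4 : ℝ) • sumV P
      + ((m + 3).choose 4 : ℝ) • (sumEdges (edges K) - sumV P)
      + ((m + 2).choose 4 : ℝ) • (sumEdges (interiorEdges P K) - sumVo P)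
      + ((m + 1).choose 4 : ℝ) • sumVo P := by
  have hV : (P ∩ lattice d).Finite := inter_lattice_eq_vertices hK ▸ vertices_finite hK
  have hVo : (intrinsicInterior ℝ P ∩ lattice d).Finite :=
    hV.subset (Set.inter_subset_inter_left _ intrinsicInterior_subset)
  refine Subtype.ext (MultilinearMap.ext fun u => ?_)
  simp only [Submodule.coe_add, Submodule.coe_smul, Submodule.coe_sub, add_apply,
    smul_apply, sub_apply, smul_eq_mul, discreteMoment, sumV, sumVo,
    sumEdges]
  rw [finsum_tensorPow_apply (smul_inter_lattice_finite hP.2 hK m) (fun x => x),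
    finsum_tensorPow_apply hV (fun x => x), finsum_tensorPow_apply hVo (fun x => x),
    finsum_tensorPow_apply (edges_finite hK), finsum_tensorPow_apply (interiorEdges_finite hK),
    finsum_smul_inter_lattice hP hK]
  -- The identities behind `ring` are `C(m+3,3) = (m+1)² + C(m+1,3)`, `C(m+3,4) = C(m+2,3) +
  -- C(m+2,4)` and `C(m+2,4) - C(m+1,4) = C(m+1,3)`.
  simp only [cast_choose_three, cast_choose_four]
  push_cast
  ring

theorem discreteMoment_zero_smul {r : ℕ} (hr : r ≠ 0) (hP : P.Nonempty) :
    discreteMoment r (((0 : ℕ) : ℝ) • P) = 0 := by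
  have : ((0 : ℕ) : ℝ) • P ∩ lattice d = {0} := by
    rw [Nat.cast_zero, Set.zero_smul_set hP]
    exact Set.inter_eq_left.2 (Set.singleton_subset_iff.2 fun i => ⟨0, by simp⟩)
  rw [discreteMoment, this, finsum_mem_singleton]
  refine Subtype.ext (MultilinearMap.ext fun u => ?_)
  rw [tensorPow_apply]
  simp [hr]

theorem isHTensorPolynomial_iff (hdim : dim P = 2) (h : PolynomialModule ℝ (SymTensor d 2)) :
    IsHTensorPolynomial 2 P h ↔ (∀ i, 4 < i → h.coeff i = 0) ∧
      ∀ n : ℕ, discreteMoment 2 ((n : ℝ) • P) =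
        ((n + 4).choose 4 : ℝ) • h.coeff 0 + ((n + 3).choose 4 : ℝ) • h.coeff 1
        + ((n + 2).choose 4 : ℝ) • h.coeff 2 + ((n + 1).choose 4 : ℝ) • h.coeff 3
        + (n.choose 4 : ℝ) • h.coeff 4 := by
  simp only [IsHTensorPolynomial, hdim, Finset.sum_range_succ, Finset.sum_range_zero, zero_add]
  rfl

/-- The `h²`-tensor polynomial of a polygon is unique. -/
theorem IsHTensorPolynomial.unique (hdim : dim P = 2) {h h' : PolynomialModule ℝ (SymTensor d 2)}
    (H : IsHTensorPolynomial 2 P h) (H' : IsHTensorPolynomial 2 P h') : h = h' := by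
  rw [isHTensorPolynomial_iff hdim] at H H'
  have key : ∀ n : ℕ, _ := fun n => (H.2 n).symm.trans (H'.2 n)
  -- At `n` the coefficient of `h_n` is `C(4,4) = 1` and those of later `h_i` vanish, so the `h_i`
  -- are determined one after another.
  have k0 := key 0
  have k1 := key 1
  have k2 := key 2
  have k3 := key 3
  have k4 := key 4
  norm_num [Nat.choose] at k0
  norm_num [Nat.choose, k0] at k1
  norm_num [Nat.choose, k0, k1] at k2
  norm_num [Nat.choose, k0, k1, k2] at k3
  norm_num [Nat.choose, k0, k1, k2, k3] at k4
  apply PolynomialModule.coeff_injective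
  ext1 i
  rcases lt_or_ge 4 i with hi | hi
  · rw [H.1 i hi, H'.1 i hi]
  · interval_cases i <;> assumption

end HTensorPolynomial

end EhrhartTensor

theorem proposition4p3 {d : ℕ} (P : Set (EhrhartTensor.E d))
    (hP : EhrhartTensor.IsLatticePolygon P)
    (K : Geometry.SimplicialComplex ℝ (EhrhartTensor.E d))
    (hK : EhrhartTensor.IsUnimodularTriangulation P K)
    (h : PolynomialModule ℝ (EhrhartTensor.SymTensor d 2)) :
    EhrhartTensor.IsHTensorPolynomial 2 P h ↔
      h = PolynomialModule.single ℝ 1 (EhrhartTensor.sumV P)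
        + PolynomialModule.single ℝ 2
            (EhrhartTensor.sumEdges (EhrhartTensor.edges K) - EhrhartTensor.sumV P)
        + PolynomialModule.single ℝ 3
            (EhrhartTensor.sumEdges (EhrhartTensor.interiorEdges P K) - EhrhartTensor.sumVo P)
        + PolynomialModule.single ℝ 4 (EhrhartTensor.sumVo P) := by
  have hne : P.Nonempty := by
    by_contra hn
    have := hP.2
    rw [Set.not_nonempty_iff_eq_empty.1 hn, EhrhartTensor.dim, vectorSpan_empty,
      finrank_bot] at this
    exact absurd this (by norm_num)
  have main : EhrhartTensor.IsHTensorPolynomial 2 P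
      (PolynomialModule.single ℝ 1 (EhrhartTensor.sumV P)
        + PolynomialModule.single ℝ 2
            (EhrhartTensor.sumEdges (EhrhartTensor.edges K) - EhrhartTensor.sumV P)
        + PolynomialModule.single ℝ 3
            (EhrhartTensor.sumEdges (EhrhartTensor.interiorEdges P K) - EhrhartTensor.sumVo P)
        + PolynomialModule.single ℝ 4 (EhrhartTensor.sumVo P)) := by
    rw [EhrhartTensor.isHTensorPolynomial_iff hP.2]
    simp only [PolynomialModule.coeff_add, PolynomialModule.coeff_single, Finsupp.add_apply,
      Finsupp.single_apply]
    constructor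
    · intro i hi
      simp [show 1 ≠ i by omega, show 2 ≠ i by omega, show 3 ≠ i by omega, show 4 ≠ i by omega]
    -- The cell decomposition needs `n ≠ 0`; at `n = 0` both sides vanish.
    · rintro (_ | m)
      · rw [EhrhartTensor.discreteMoment_zero_smul two_ne_zero hne]
        simp [Nat.choose]
      · rw [EhrhartTensor.discreteMoment_smul hP hK]
        simp [add_assoc, add_comm, add_left_comm]
  exact ⟨fun H => H.unique hP.2 main, fun H => H ▸ main⟩
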